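/- Let $n$ be a positive integer (the case $n=0$ is allowed too), let $q$ be a nonzero complex number that is not a root of unity, fix a square root $q^{1/2}$, and let $\alpha\in\mathbb C$. Let $\langle\cdot,\cdot\rangle$ be the bilinear form on $\frac12\bigoplus_{i=1}^n\mathbb Z\varepsilon_i$ with $\langle\varepsilon_i,\varepsilon_j\rangle=\delta_{ij}$. Let $U_q=U_q(\mathfrak{gl}_n)$ be the associative $\mathbb C$-algebra generated by $e_k,f_k$ ($1\le k\le n-1$) and $q^\lambda$ ($\lambda\in\frac12\bigoplus_i\mathbb Z\varepsilon_i$) with relations $q^0=1$, $q^{\lambda+\mu}=q^\lambda q^\mu$, $q^\lambda e_kq^{-\lambda}=q^{\langle\lambda,\varepsilon_k-\varepsilon_{k+1}\rangle}e_k$, $q^\lambda f_kq^{-\lambda}=q^{-\langle\lambda,\varepsilon_k-\varepsilon_{k+1}\rangle}f_k$, $e_kf_l-f_le_k=\delta_{kl}\frac{q^{\varepsilon_k-\varepsilon_{k+1}}-q^{-(\varepsilon_k-\varepsilon_{k+1})}}{q-q^{-1}}$, $e_k^2e_l-(q+q^{-1})e_ke_le_k+e_le_k^2=0=f_k^2f_l-(q+q^{-1})f_kf_lf_k+f_lf_k^2$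 for $|k-l|=1$, and $e_ke_l=e_le_k$, $f_kf_l=f_lf_k$ for $|k-l|\ge2$. Its coproduct is $\Delta(q^\lambda)=q^\lambda\otimes q^\lambda$ and $\Delta(y_k)=y_k\otimes q^{-(\varepsilon_k-\varepsilon_{k+1})/2}+q^{(\varepsilon_k-\varepsilon_{k+1})/2}\otimes y_k$ for $y=e,f$. It acts on $\mathbb C^n$ with standard basis $v_1,\dots,v_n$ by $q^\lambda v_j=q^{\langle\lambda,\varepsilon_j\rangle}v_j$, $e_kv_j=\delta_{j,k+1}v_k$, $f_kv_j=\delta_{jk}v_{k+1}$, and on $(\mathbb C^n)^{\otimes n}$ through the iterated coproduct. Let $A_q$ be the associative $\mathbb C$-algebra generated by $x_{ij}$ ($1\le i,j\le n$) with relations $x_{ik}x_{jk}=q\,x_{jk}x_{ik}$ and $x_{ki}x_{kj}=q\,x_{kj}x_{ki}$ for $i<j$, and $x_{il}x_{jk}=x_{jk}x_{il}$ and $x_{ik}x_{jl}-x_{jl}x_{ik}=(q-q^{-1})x_{il}x_{jk}$ for $i<j$, $k<l$. Let $\rho$ be the representation of $U_q$ on $A_q$ given by $\rho(q^\lambda)x_{ij}=q^{\langle\lambda,\varepsilon_j\rangle}x_{ij}$,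 $\rho(e_k)x_{ij}=\delta_{j,k+1}x_{ik}$, $\rho(f_k)x_{ij}=\delta_{jk}x_{i,k+1}$, extended to products by the coproduct (with $\rho(q^\lambda)1=1$, $\rho(e_k)1=\rho(f_k)1=0$). For $1\le j_1,\dots,j_n\le n$ put $$D(j_1,\dots,j_n)=\sum_{w\in\mathfrak S_n}\alpha^{n-\mathrm{cyc}(w)}q^{\mathrm{inv}(w)}x_{w(1)j_1}\cdots x_{w(n)j_n}\in A_q,$$ where $\mathrm{cyc}(w)$ is the number of cycles of $w$ (fixed points included) and $\mathrm{inv}(w)$ the number of inversions, and let $\det_q^{(\alpha)}=D(1,2,\dots,n)$ and $V_{n,q}^{(\alpha)}=\rho(U_q)\cdot\det_q^{(\alpha)}$. Then $$V_{n,q}^{(\alpha)}=\sum_{1\le j_1,\dots,j_n\le n}\mathbb C\cdot D(j_1,\dots,j_n),$$ and the linear map $\Phi:(\mathbb C^n)^{\otimes n}\to V_{n,q}^{(\alpha)}$ with $v_{j_1}\otimes\cdots\otimes v_{j_n}\mapsto D(j_1,\dots,j_n)$ is a surjective homomorphism of $U_q$-modules. -/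

import Mathlib

open scoped TensorProduct

set_option linter.unusedSimpArgs false
set_option linter.unnecessarySeqFocus false

namespace QuantumAlpha

/-- The index `k`, as an element of `{1, …, n}`, for a label `k` of a simple root
(`1 ≤ k ≤ n - 1`; everything is numbered from `0` here). -/
def lo {n : ℕ} (k : Fin (n - 1)) : Fin n := ⟨k, by omega⟩

/-- The index `k + 1`, as an element of `{1, …, n}`. -/
def hi {n : ℕ} (k : Fin (n - 1)) : Fin n := ⟨k + 1, by omega⟩

/-- The simple root `ε_k - ε_{k+1}` of `gl_n` in `ℤ ε_1 + ⋯ + ℤ ε_n`. -/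
def simpleRoot {n : ℕ} (k : Fin (n - 1)) : Fin n → ℤ :=
  Pi.single (lo k) 1 - Pi.single (hi k) 1

/-- Generators of `U_q(gl_n)`: `e_k`, `f_k` for `1 ≤ k ≤ n - 1` and `q^λ` for `λ` in `(1/2) ∑ ℤ ε_i`.
The generator `qpow m` with `m : Fin n → ℤ` stands for `q^λ`, `λ = (1/2) ∑ m_i ε_i`. -/
inductive UqGen (n : ℕ) : Type
  | e (k : Fin (n - 1))
  | f (k : Fin (n - 1))
  | qpow (m : Fin n → ℤ)

/-- The defining relations of `U_q(gl_n)`, as a property of elements `K m` (for `q^λ`, `λ = m / 2`),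
`E k`, `F k` of an algebra. Used only to construct algebra maps out of `U_q(gl_n)`. -/
structure UqRelations (n : ℕ) (r : ℂˣ) {R : Type*} [Ring R] [Algebra ℂ R]
    (K : (Fin n → ℤ) → R) (E F : Fin (n - 1) → R) : Prop where
  K_zero : K 0 = 1
  K_add : ∀ l m, K (l + m) = K l * K m
  K_E : ∀ m k, K m * E k = ((r : ℂ) ^ (m (lo k) - m (hi k))) • (E k * K m)
  K_F : ∀ m k, K m * F k = ((r : ℂ) ^ (-(m (lo k) - m (hi k)))) • (F k * K m)
  E_F : ∀ k, ((r : ℂ) ^ 2 - ((r : ℂ) ^ 2)⁻¹) • (E k * F k - F k * E k)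
    = K (simpleRoot k + simpleRoot k) - K (-(simpleRoot k + simpleRoot k))
  E_F_ne : ∀ k l, k ≠ l → E k * F l = F l * E k
  serre_E : ∀ k l : Fin (n - 1), ((k : ℕ) + 1 = l ∨ (l : ℕ) + 1 = k) →
    E k * E k * E l - ((r : ℂ) ^ 2 + ((r : ℂ) ^ 2)⁻¹) • (E k * E l * E k) + E l * E k * E k = 0
  serre_F : ∀ k l : Fin (n - 1), ((k : ℕ) + 1 = l ∨ (l : ℕ) + 1 = k) →
    F k * F k * F l - ((r : ℂ) ^ 2 + ((r : ℂ) ^ 2)⁻¹) • (F k * F l * F k) + F l * F k * F k = 0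
  comm_E : ∀ k l : Fin (n - 1), ((k : ℕ) + 1 < l ∨ (l : ℕ) + 1 < k) → E k * E l = E l * E k
  comm_F : ∀ k l : Fin (n - 1), ((k : ℕ) + 1 < l ∨ (l : ℕ) + 1 < k) → F k * F l = F l * F k

theorem serre_add_eq {R : Type*} [Ring R] [Algebra ℂ R] (q : ℂ) (hq : q ≠ 0) (a a' b b' : R)
    (h1 : a' * a = (q ^ 2) • (a * a')) (h2 : b' * a = q⁻¹ • (a * b'))
    (h3 : a' * b = q⁻¹ • (b * a')) :
    (a + a') * (a + a') * (b + b') - (q + q⁻¹) • ((a + a') * (b + b') * (a + a'))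
      + (b + b') * (a + a') * (a + a')
      = (a * a * b - (q + q⁻¹) • (a * b * a) + b * a * a)
        + (a' * a' * b' - (q + q⁻¹) • (a' * b' * a') + b' * a' * a') := by
  have h1' : ∀ x, a' * (a * x) = (q ^ 2) • (a * (a' * x)) := fun x => by
    rw [← mul_assoc, h1, smul_mul_assoc, mul_assoc]
  have h2' : ∀ x, b' * (a * x) = q⁻¹ • (a * (b' * x)) := fun x => by
    rw [← mul_assoc, h2, smul_mul_assoc, mul_assoc]
  have h3' : ∀ x, a' * (b * x) = q⁻¹ • (b * (a' * x)) := fun x => by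
    rw [← mul_assoc, h3, smul_mul_assoc, mul_assoc]
  simp only [mul_assoc, mul_add, add_mul, h1, h2, h3, h1', h2', h3', mul_smul_comm, smul_mul_assoc,
    smul_smul]
  match_scalars <;> field_simp <;> ring

theorem serre_add {R : Type*} [Ring R] [Algebra ℂ R] (q : ℂ) (hq : q ≠ 0) (a a' b b' : R)
    (h1 : a' * a = (q ^ 2) • (a * a')) (h2 : b' * a = q⁻¹ • (a * b'))
    (h3 : a' * b = q⁻¹ • (b * a'))
    (s1 : a * a * b - (q + q⁻¹) • (a * b * a) + b * a * a = 0)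
    (s2 : a' * a' * b' - (q + q⁻¹) • (a' * b' * a') + b' * a' * a' = 0) :
    (a + a') * (a + a') * (b + b') - (q + q⁻¹) • ((a + a') * (b + b') * (a + a'))
      + (b + b') * (a + a') * (a + a') = 0 := by
  rw [serre_add_eq q hq a a' b b' h1 h2 h3, s1, s2, add_zero]

theorem serre_sum {R : Type*} [Ring R] [Algebra ℂ R] (q : ℂ) (hq : q ≠ 0) {N : ℕ}
    (a b : Fin N → R)
    (h1 : ∀ l m, l < m → a m * a l = (q ^ 2) • (a l * a m))
    (h2 : ∀ l m, l < m → b m * a l = q⁻¹ • (a l * b m))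
    (h3 : ∀ l m, l < m → a m * b l = q⁻¹ • (b l * a m))
    (s : ∀ l, a l * a l * b l - (q + q⁻¹) • (a l * b l * a l) + b l * a l * a l = 0) :
    (∑ l, a l) * (∑ l, a l) * (∑ l, b l) - (q + q⁻¹) • ((∑ l, a l) * (∑ l, b l) * (∑ l, a l))
      + (∑ l, b l) * (∑ l, a l) * (∑ l, a l) = 0 := by
  induction N with
  | zero => simp
  | succ N ih =>
    simp only [Fin.sum_univ_castSucc]
    refine serre_add q hq _ _ _ _ ?_ ?_ ?_ (ih _ _ ?_ ?_ ?_ ?_) (s _)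
    · simp only [Finset.mul_sum, Finset.sum_mul, Finset.smul_sum]
      exact Finset.sum_congr rfl fun i _ => h1 _ _ (Fin.castSucc_lt_last i)
    · simp only [Finset.mul_sum, Finset.sum_mul, Finset.smul_sum]
      exact Finset.sum_congr rfl fun i _ => h2 _ _ (Fin.castSucc_lt_last i)
    · simp only [Finset.mul_sum, Finset.sum_mul, Finset.smul_sum]
      exact Finset.sum_congr rfl fun i _ => h3 _ _ (Fin.castSucc_lt_last i)
    · exact fun l m h => h1 _ _ (by simpa using h)
    · exact fun l m h => h2 _ _ (by simpa using h)
    · exact fun l m h => h3 _ _ (by simpa using h)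
    · exact fun l => s _

/-- The free generators. -/
noncomputable abbrev genι {n : ℕ} (x : UqGen n) : FreeAlgebra ℂ (UqGen n) :=
  FreeAlgebra.ι ℂ x

/-- The fundamental relations of `U_q(gl_n)`, where `q = r ^ 2`, i.e. `r` is the chosen square root
of `q`, so that `q ^ ⟨λ, ε_k - ε_{k+1}⟩ = r ^ (m_k - m_{k+1})` for `λ = m / 2`:
`q^0 = 1`, `q^{λ+μ} = q^λ q^μ`, `q^λ e_k = q^{⟨λ, ε_k - ε_{k+1}⟩} e_k q^λ`,
`q^λ f_k = q^{-⟨λ, ε_k - ε_{k+1}⟩} f_k q^λ`,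
`(q - q⁻¹) [e_k, f_l] = δ_{kl} (q^{ε_k - ε_{k+1}} - q^{-(ε_k - ε_{k+1})})` (`[e_k, f_l] = 0` if `k ≠ l`),
and the quantum Serre relations. -/
inductive UqRel (n : ℕ) (r : ℂˣ) :
    FreeAlgebra ℂ (UqGen n) → FreeAlgebra ℂ (UqGen n) → Prop
  | qpow_zero : UqRel n r (genι (.qpow 0)) 1
  | qpow_add (l m : Fin n → ℤ) :
      UqRel n r (genι (.qpow (l + m)))
        (genι (.qpow l) * genι (.qpow m))
  | qpow_e (m : Fin n → ℤ) (k : Fin (n - 1)) :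
      UqRel n r (genι (.qpow m) * genι (.e k))
        (((r : ℂ) ^ (m (lo k) - m (hi k))) •
          (genι (.e k) * genι (.qpow m)))
  | qpow_f (m : Fin n → ℤ) (k : Fin (n - 1)) :
      UqRel n r (genι (.qpow m) * genι (.f k))
        (((r : ℂ) ^ (-(m (lo k) - m (hi k)))) •
          (genι (.f k) * genι (.qpow m)))
  | e_f (k : Fin (n - 1)) :
      UqRel n r
        (((r : ℂ) ^ 2 - ((r : ℂ) ^ 2)⁻¹) •
          (genι (.e k) * genι (.f k)
            - genι (.f k) * genι (.e k)))
        (genι (.qpow (simpleRoot k + simpleRoot k))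
          - genι (.qpow (-(simpleRoot k + simpleRoot k))))
  | e_f_ne (k l : Fin (n - 1)) (h : k ≠ l) :
      UqRel n r (genι (.e k) * genι (.f l))
        (genι (.f l) * genι (.e k))
  | serre_e (k l : Fin (n - 1)) (h : (k : ℕ) + 1 = l ∨ (l : ℕ) + 1 = k) :
      UqRel n r
        (genι (.e k) * genι (.e k) * genι (.e l)
          - ((r : ℂ) ^ 2 + ((r : ℂ) ^ 2)⁻¹) •
            (genι (.e k) * genι (.e l) * genι (.e k))
          + genι (.e l) * genι (.e k) * genι (.e k))
        0
  | serre_f (k l : Fin (n - 1)) (h : (k : ℕ) + 1 = l ∨ (l : ℕ) + 1 = k) :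
      UqRel n r
        (genι (.f k) * genι (.f k) * genι (.f l)
          - ((r : ℂ) ^ 2 + ((r : ℂ) ^ 2)⁻¹) •
            (genι (.f k) * genι (.f l) * genι (.f k))
          + genι (.f l) * genι (.f k) * genι (.f k))
        0
  | comm_e (k l : Fin (n - 1)) (h : (k : ℕ) + 1 < l ∨ (l : ℕ) + 1 < k) :
      UqRel n r (genι (.e k) * genι (.e l))
        (genι (.e l) * genι (.e k))
  | comm_f (k l : Fin (n - 1)) (h : (k : ℕ) + 1 < l ∨ (l : ℕ) + 1 < k) :
      UqRel n r (genι (.f k) * genι (.f l))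
        (genι (.f l) * genι (.f k))

/-- The quantum enveloping algebra `U_q(gl_n)`, `q = r ^ 2`. -/
abbrev Uq (n : ℕ) (r : ℂˣ) : Type := RingQuot (UqRel n r)

namespace Uq

variable {n : ℕ} {r : ℂˣ}

noncomputable def gen (r : ℂˣ) (x : UqGen n) : Uq n r :=
  RingQuot.mkAlgHom ℂ (UqRel n r) (FreeAlgebra.ι ℂ x)

noncomputable def e (r : ℂˣ) (k : Fin (n - 1)) : Uq n r := gen r (.e k)

noncomputable def f (r : ℂˣ) (k : Fin (n - 1)) : Uq n r := gen r (.f k)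

noncomputable def qpow (r : ℂˣ) (m : Fin n → ℤ) : Uq n r := gen r (.qpow m)

theorem relations (n : ℕ) (r : ℂˣ) :
    UqRelations n r (qpow r) (e r) (f r) where
  K_zero := by simpa [qpow, gen] using RingQuot.mkAlgHom_rel ℂ (UqRel.qpow_zero (n := n) (r := r))
  K_add l m := by simpa [qpow, gen] using RingQuot.mkAlgHom_rel ℂ (UqRel.qpow_add (r := r) l m)
  K_E m k := by simpa [qpow, e, gen] using RingQuot.mkAlgHom_rel ℂ (UqRel.qpow_e (r := r) m k)
  K_F m k := by
    simpa [qpow, f, gen, -neg_sub] using RingQuot.mkAlgHom_rel ℂ (UqRel.qpow_f (r := r) m k)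
  E_F k := by
    simpa only [e, f, qpow, gen, map_smul, map_sub, map_mul] using RingQuot.mkAlgHom_rel ℂ (UqRel.e_f (r := r) k)
  E_F_ne k l h := by
    simpa only [e, f, qpow, gen, map_mul] using RingQuot.mkAlgHom_rel ℂ (UqRel.e_f_ne (r := r) k l h)
  serre_E k l h := by
    simpa only [e, f, qpow, gen, map_smul, map_sub, map_add, map_mul, map_zero] using
      RingQuot.mkAlgHom_rel ℂ (UqRel.serre_e (r := r) k l h)
  serre_F k l h := by
    simpa only [e, f, qpow, gen, map_smul, map_sub, map_add, map_mul, map_zero] using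
      RingQuot.mkAlgHom_rel ℂ (UqRel.serre_f (r := r) k l h)
  comm_E k l h := by
    simpa only [e, f, qpow, gen, map_mul] using RingQuot.mkAlgHom_rel ℂ (UqRel.comm_e (r := r) k l h)
  comm_F k l h := by
    simpa only [e, f, qpow, gen, map_mul] using RingQuot.mkAlgHom_rel ℂ (UqRel.comm_f (r := r) k l h)

def genMap {R : Type*} (K : (Fin n → ℤ) → R) (E F : Fin (n - 1) → R) : UqGen n → R
  | .e k => E k
  | .f k => F k
  | .qpow m => K m

noncomputable def lift {R : Type*} [Ring R] [Algebra ℂ R]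
    {K : (Fin n → ℤ) → R} {E F : Fin (n - 1) → R} (h : UqRelations n r K E F) :
    Uq n r →ₐ[ℂ] R :=
  RingQuot.liftAlgHom ℂ ⟨FreeAlgebra.lift ℂ (genMap K E F), by
    intro x y hxy
    cases hxy with
    | qpow_zero => simpa [genMap] using h.K_zero
    | qpow_add l m => simpa [genMap] using h.K_add l m
    | qpow_e m k => simpa [genMap] using h.K_E m k
    | qpow_f m k => simpa [genMap, -neg_sub] using h.K_F m k
    | e_f k =>
      simpa only [genMap, map_smul, map_sub, map_mul, FreeAlgebra.lift_ι_apply] using h.E_F k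
    | e_f_ne k l hkl => simpa [genMap] using h.E_F_ne k l hkl
    | serre_e k l hkl =>
      simpa only [genMap, map_smul, map_sub, map_mul, map_add, map_zero,
        FreeAlgebra.lift_ι_apply] using h.serre_E k l hkl
    | serre_f k l hkl =>
      simpa only [genMap, map_smul, map_sub, map_mul, map_add, map_zero,
        FreeAlgebra.lift_ι_apply] using h.serre_F k l hkl
    | comm_e k l hkl => simpa [genMap] using h.comm_E k l hkl
    | comm_f k l hkl => simpa [genMap] using h.comm_F k l hkl⟩

section lift

variable {R : Type*} [Ring R] [Algebra ℂ R]
  {K : (Fin n → ℤ) → R} {E F : Fin (n - 1) → R} (h : UqRelations n r K E F)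

@[simp] theorem lift_e (k : Fin (n - 1)) : lift h (e r k) = E k := by
  simp [lift, e, gen, genMap]

@[simp] theorem lift_f (k : Fin (n - 1)) : lift h (f r k) = F k := by
  simp [lift, f, gen, genMap]

@[simp] theorem lift_qpow (m : Fin n → ℤ) : lift h (qpow r m) = K m := by
  simp [lift, qpow, gen, genMap]

end lift

end Uq

theorem UqRelations.map {n : ℕ} {r : ℂˣ} {R S : Type*} [Ring R] [Algebra ℂ R]
    [Ring S] [Algebra ℂ S] {K : (Fin n → ℤ) → R} {E F : Fin (n - 1) → R}
    (h : UqRelations n r K E F) (φ : R →ₐ[ℂ] S) :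
    UqRelations n r (fun m => φ (K m)) (fun k => φ (E k)) (fun k => φ (F k)) where
  K_zero := by rw [h.K_zero, map_one]
  K_add l m := by rw [h.K_add, map_mul]
  K_E m k := by rw [← map_mul, h.K_E, map_smul, map_mul]
  K_F m k := by rw [← map_mul, h.K_F, map_smul, map_mul]
  E_F k := by simp only [← map_mul, ← map_sub, ← map_smul, h.E_F]
  E_F_ne k l hkl := by simp only [← map_mul, h.E_F_ne k l hkl]
  serre_E k l hkl := by
    simp only [← map_mul, ← map_sub, ← map_smul, ← map_add, h.serre_E k l hkl, map_zero]
  serre_F k l hkl := by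
    simp only [← map_mul, ← map_sub, ← map_smul, ← map_add, h.serre_F k l hkl, map_zero]
  comm_E k l hkl := by simp only [← map_mul, h.comm_E k l hkl]
  comm_F k l hkl := by simp only [← map_mul, h.comm_F k l hkl]

theorem lo_ne_hi {n : ℕ} (k : Fin (n - 1)) : lo k ≠ hi k := by
  simp [lo, hi, Fin.ext_iff]

theorem vector_relations (n : ℕ) (r : ℂˣ) :
    UqRelations n r
      (fun m : Fin n → ℤ => Matrix.diagonal fun j => (r : ℂ) ^ (m j))
      (fun k => Matrix.single (lo k) (hi k) (1 : ℂ))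
      (fun k => Matrix.single (hi k) (lo k) (1 : ℂ)) where
  K_zero := by simp
  K_add l m := by
    simp [Matrix.diagonal_mul_diagonal, zpow_add₀ r.ne_zero]
  K_E m k := by
    ext i j
    simp only [Matrix.diagonal_mul, Matrix.mul_diagonal, Matrix.smul_apply, Matrix.single_apply,
      smul_eq_mul]
    split_ifs with h
    · obtain ⟨rfl, rfl⟩ := h
      rw [sub_eq_add_neg, zpow_add₀ r.ne_zero, zpow_neg]
      field_simp
    · simp
  K_F m k := by
    ext i j
    simp only [Matrix.diagonal_mul, Matrix.mul_diagonal, Matrix.smul_apply, Matrix.single_apply,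
      smul_eq_mul]
    split_ifs with h
    · obtain ⟨rfl, rfl⟩ := h
      rw [neg_sub, sub_eq_add_neg, zpow_add₀ r.ne_zero, zpow_neg]
      field_simp
    · simp
  E_F k := by
    have hne := lo_ne_hi k
    ext i j
    by_cases hij : i = j
    · subst hij
      by_cases h1 : i = lo k
      · subst h1
        simp [simpleRoot, hne, hne.symm, zpow_neg, zpow_ofNat]
      · by_cases h2 : i = hi k
        · subst h2
          simp [simpleRoot, hne, hne.symm, zpow_neg, zpow_ofNat]
        · simp [simpleRoot, h1, h2, Ne.symm h1, Ne.symm h2]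
    · simp [hij, Matrix.single_apply]
      grind
  E_F_ne k l h := by
    have h' : (k : ℕ) ≠ l := fun h' => h (Fin.ext h')
    rw [Matrix.single_mul_single_of_ne, Matrix.single_mul_single_of_ne] <;>
      simp [lo, hi, Fin.ext_iff] <;> omega
  serre_E k l h := by
    have h0 : Matrix.single (lo k) (hi k) (1 : ℂ) * Matrix.single (lo k) (hi k) 1 = 0 :=
      Matrix.single_mul_single_of_ne _ _ _ _ (lo_ne_hi k).symm _
    have h1 : Matrix.single (lo k) (hi k) (1 : ℂ) * Matrix.single (lo l) (hi l) 1
        * Matrix.single (lo k) (hi k) 1 = 0 := by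
      by_cases h1 : hi k = lo l
      · have h2 : hi l ≠ lo k := by
          simp only [lo, hi, Fin.ext_iff, ne_eq] at h1 ⊢
          omega
        rw [Matrix.mul_assoc, Matrix.single_mul_single_of_ne _ _ _ _ h2, mul_zero]
      · rw [Matrix.single_mul_single_of_ne _ _ _ _ h1, zero_mul]
    rw [h0, h1, Matrix.mul_assoc, h0]
    simp
  serre_F k l h := by
    have h0 : Matrix.single (hi k) (lo k) (1 : ℂ) * Matrix.single (hi k) (lo k) 1 = 0 :=
      Matrix.single_mul_single_of_ne _ _ _ _ (lo_ne_hi k) _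
    have h1 : Matrix.single (hi k) (lo k) (1 : ℂ) * Matrix.single (hi l) (lo l) 1
        * Matrix.single (hi k) (lo k) 1 = 0 := by
      by_cases h1 : lo k = hi l
      · have h2 : lo l ≠ hi k := by
          simp only [lo, hi, Fin.ext_iff, ne_eq] at h1 ⊢
          omega
        rw [Matrix.mul_assoc, Matrix.single_mul_single_of_ne _ _ _ _ h2, mul_zero]
      · rw [Matrix.single_mul_single_of_ne _ _ _ _ h1, zero_mul]
    rw [h0, h1, Matrix.mul_assoc, h0]
    simp
  comm_E k l h := by
    rw [Matrix.single_mul_single_of_ne, Matrix.single_mul_single_of_ne] <;>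
      simp [lo, hi, Fin.ext_iff] <;> omega
  comm_F k l h := by
    rw [Matrix.single_mul_single_of_ne, Matrix.single_mul_single_of_ne] <;>
      simp [lo, hi, Fin.ext_iff] <;> omega

theorem vector_relations_end (n : ℕ) (r : ℂˣ) :
    UqRelations n r
      (fun m : Fin n → ℤ => Matrix.toLin' (Matrix.diagonal fun j => (r : ℂ) ^ (m j)))
      (fun k => Matrix.toLin' (Matrix.single (lo k) (hi k) (1 : ℂ)))
      (fun k => Matrix.toLin' (Matrix.single (hi k) (lo k) (1 : ℂ))) :=
  (vector_relations n r).map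
    (Matrix.toLinAlgEquiv' : Matrix (Fin n) (Fin n) ℂ ≃ₐ[ℂ] _).toAlgHom

/-- The vector representation on `ℂ^n`: `q^λ v_j = q^{⟨λ, ε_j⟩} v_j`, `e_k v_j = δ_{j,k+1} v_k`,
`f_k v_j = δ_{j,k} v_{k+1}`. -/
noncomputable def vectorRep (n : ℕ) (r : ℂˣ) : Uq n r →ₐ[ℂ] Module.End ℂ (Fin n → ℂ) :=
  Uq.lift (vector_relations_end n r)

section TensorRep

variable {N : ℕ} {V : Type*} [AddCommGroup V] [Module ℂ V]

/-- The operator `g_1 ⊗ ⋯ ⊗ g_N` on `V^{⊗N}`. -/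
noncomputable def tmap (g : Fin N → Module.End ℂ V) :
    Module.End ℂ (⨂[ℂ] _ : Fin N, V) :=
  PiTensorProduct.map g

/-- The operator `x ⊗ ⋯ ⊗ x ⊗ y ⊗ z ⊗ ⋯ ⊗ z` on `V^{⊗N}` with `y` in position `l`. -/
noncomputable def siteOp (x y z : Module.End ℂ V) (l : Fin N) :
    Module.End ℂ (⨂[ℂ] _ : Fin N, V) :=
  tmap fun i => if i < l then x else if i = l then y else z

theorem tmap_mul (f g : Fin N → Module.End ℂ V) :
    tmap f * tmap g = tmap fun i => f i * g i :=
  (PiTensorProduct.map_mul f g).symm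

theorem tmap_one : tmap (fun _ : Fin N => (1 : Module.End ℂ V)) = 1 :=
  PiTensorProduct.map_one

theorem tmap_smul (c : Fin N → ℂ) (f : Fin N → Module.End ℂ V) :
    tmap (fun i => c i • f i) = (∏ i, c i) • tmap f :=
  (PiTensorProduct.mapMultilinear ℂ (fun _ : Fin N => V) (fun _ => V)).map_smul_univ c f

theorem siteOp_mul_siteOp {x y z x' y' z' : Module.End ℂ V} {c d : ℂ} {l m : Fin N}
    (hlm : l < m) (h1 : x' * x = x * x') (h2 : x' * y = c • (y * x'))
    (h3 : x' * z = z * x') (h4 : y' * z = d • (z * y')) (h5 : z' * z = z * z') :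
    siteOp x' y' z' m * siteOp x y z l = (c * d) • (siteOp x y z l * siteOp x' y' z' m) := by
  have hc : c * d = ∏ i : Fin N, (if i = l then c else if i = m then d else 1) := by
    rw [Fintype.prod_eq_mul l m hlm.ne]
    · simp [hlm.ne']
    · intro i hi
      simp [hi.1, hi.2]
  rw [hc, siteOp, siteOp, tmap_mul, tmap_mul, ← tmap_smul]
  congr 1
  funext i
  rcases lt_trichotomy i l with h | rfl | h
  · have := h.trans hlm
    simp [h, this, h.ne, this.ne, h1]
  · simp [hlm, h2]
  · rcases lt_trichotomy i m with h' | rfl | h'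
    · simp [h', h.ne', h'.ne, h.not_gt, h3]
    · simp [h.not_gt, h.ne', h4]
    · simp [h.not_gt, h.ne', h'.not_gt, h'.ne', h5]

theorem tmap_mul_siteOp {x y z w : Module.End ℂ V} {c : ℂ} {l : Fin N}
    (h1 : w * x = x * w) (h2 : w * y = c • (y * w)) (h3 : w * z = z * w) :
    tmap (fun _ => w) * siteOp x y z l = c • (siteOp x y z l * tmap (fun _ => w)) := by
  have hc : c = ∏ i : Fin N, (if i = l then c else 1) := by simp
  conv_rhs => rw [hc]
  rw [siteOp, tmap_mul, tmap_mul, ← tmap_smul]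
  congr 1
  funext i
  rcases lt_trichotomy i l with h | rfl | h
  · simp [h, h.ne, h1]
  · simp [h2]
  · simp [h.not_gt, h.ne', h3]

theorem siteOp_mul_same (x y z x' y' z' : Module.End ℂ V) (l : Fin N) :
    siteOp x y z l * siteOp x' y' z' l = siteOp (x * x') (y * y') (z * z') l := by
  rw [siteOp, siteOp, tmap_mul, siteOp]
  congr 1
  funext i
  split_ifs <;> rfl

theorem siteOp_eq_update (x y z : Module.End ℂ V) (l : Fin N) :
    siteOp x y z l = PiTensorProduct.mapMultilinear ℂ (fun _ : Fin N => V) (fun _ => V)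
      (Function.update (fun i => if i < l then x else z) l y) := by
  change PiTensorProduct.map _ = PiTensorProduct.map _
  congr 1
  funext i
  by_cases h : i = l
  · subst h; simp
  · simp [h]

theorem siteOp_sub (x y y' z : Module.End ℂ V) (l : Fin N) :
    siteOp x (y - y') z l = siteOp x y z l - siteOp x y' z l := by
  simp only [siteOp_eq_update, MultilinearMap.map_update_sub]

theorem siteOp_add (x y y' z : Module.End ℂ V) (l : Fin N) :
    siteOp x (y + y') z l = siteOp x y z l + siteOp x y' z l := by
  simp only [siteOp_eq_update, MultilinearMap.map_update_add]

theorem siteOp_smul (c : ℂ) (x y z : Module.End ℂ V) (l : Fin N) :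
    siteOp x (c • y) z l = c • siteOp x y z l := by
  simp only [siteOp_eq_update, MultilinearMap.map_update_smul]

theorem siteOp_zero (x z : Module.End ℂ V) (l : Fin N) :
    siteOp x 0 z l = 0 := by
  simpa using siteOp_smul 0 x 0 z l

theorem sum_siteOp_sub (x z : Module.End ℂ V) :
    ∑ l : Fin N, (siteOp x x z l - siteOp x z z l)
      = tmap (fun _ => x) - tmap (fun _ => z) := by
  let T : ℕ → Module.End ℂ (⨂[ℂ] _ : Fin N, V) := fun t =>
    tmap fun i => if (i : ℕ) < t then x else z
  have h : ∀ l : Fin N, siteOp x x z l - siteOp x z z l = T (l + 1) - T l := by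
    intro l
    congr 1
    · simp only [siteOp, T]
      congr 1
      funext i
      by_cases h1 : i < l
      · have : (i : ℕ) < l + 1 := by omega
        simp [h1, this]
      · by_cases h2 : i = l
        · simp [h2]
        · have : ¬ (i : ℕ) < l + 1 := by
            simp only [Fin.lt_def, Fin.ext_iff] at h1 h2; omega
          simp [h1, h2, this]
    · simp only [siteOp, T]
      congr 1
      funext i
      by_cases h1 : i < l
      · simp [h1]
      · simp [h1]
  simp only [h]
  rw [Fin.sum_univ_eq_sum_range (fun t => T (t + 1) - T t), Finset.sum_range_sub]
  simp [T]

theorem commutator_sum {R : Type*} [Ring R] (a b : Fin N → R)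
    (h : ∀ l m, l ≠ m → a l * b m = b m * a l) :
    (∑ l, a l) * (∑ l, b l) - (∑ l, b l) * (∑ l, a l) = ∑ l, (a l * b l - b l * a l) := by
  rw [Finset.sum_mul_sum, Finset.sum_mul_sum, Finset.sum_comm (s := Finset.univ)
    (f := fun i j => b i * a j), ← Finset.sum_sub_distrib]
  refine Finset.sum_congr rfl fun l _ => ?_
  rw [← Finset.sum_sub_distrib]
  refine Finset.sum_eq_single l (fun m _ hm => ?_) (by simp)
  rw [h l m hm.symm, sub_self]

end TensorRep

theorem UqRelations.K_comm {n : ℕ} {r : ℂˣ} {R : Type*} [Ring R] [Algebra ℂ R]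
    {K : (Fin n → ℤ) → R} {E F : Fin (n - 1) → R} (h : UqRelations n r K E F)
    (l m : Fin n → ℤ) : K l * K m = K m * K l := by
  rw [← h.K_add, ← h.K_add, add_comm]

/-- The bilinear form `⟨ε_k - ε_{k+1}, ε_l - ε_{l+1}⟩`. -/
def pairing {n : ℕ} (k l : Fin (n - 1)) : ℤ := simpleRoot k (lo l) - simpleRoot k (hi l)

theorem pairing_symm {n : ℕ} (k l : Fin (n - 1)) : pairing k l = pairing l k := by
  simp only [pairing, simpleRoot, lo, hi, Pi.sub_apply, Pi.single_apply, Fin.ext_iff]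
  grind

theorem pairing_self {n : ℕ} (k : Fin (n - 1)) : pairing k k = 2 := by
  simp [pairing, simpleRoot, lo, hi]

theorem pairing_adj {n : ℕ} (k l : Fin (n - 1)) (h : (k : ℕ) + 1 = l ∨ (l : ℕ) + 1 = k) :
    pairing k l = -1 := by
  simp only [pairing, simpleRoot, lo, hi, Pi.sub_apply, Pi.single_apply, Fin.ext_iff]
  grind

theorem pairing_far {n : ℕ} (k l : Fin (n - 1)) (h : (k : ℕ) + 1 < l ∨ (l : ℕ) + 1 < k) :
    pairing k l = 0 := by
  simp only [pairing, simpleRoot, lo, hi, Pi.sub_apply, Pi.single_apply, Fin.ext_iff]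
  grind

theorem zpow_mul_zpow_two (r : ℂˣ) : (r : ℂ) ^ (2 : ℤ) * (r : ℂ) ^ (2 : ℤ) = ((r : ℂ) ^ 2) ^ 2 := by
  norm_cast
  rw [sq (r ^ 2)]

theorem zpow_mul_zpow_neg (r : ℂˣ) :
    (r : ℂ) ^ (-1 : ℤ) * (r : ℂ) ^ (-1 : ℤ) = ((r : ℂ) ^ 2)⁻¹ := by
  have := r.ne_zero
  rw [zpow_neg_one]; field_simp

theorem zpow_mul_zpow_neg_two (r : ℂˣ) :
    (r : ℂ) ^ (-(2 : ℤ)) * (r : ℂ) ^ (-(2 : ℤ)) = (((r : ℂ) ^ 2)⁻¹) ^ 2 := by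
  rw [zpow_neg, ← mul_inv, zpow_mul_zpow_two, inv_pow]

theorem zpow_mul_zpow_one (r : ℂˣ) :
    (r : ℂ) ^ (-(-1 : ℤ)) * (r : ℂ) ^ (-(-1 : ℤ)) = (r : ℂ) ^ 2 := by
  simp [sq]

section

variable {n : ℕ} {r : ℂˣ} {V : Type*} [AddCommGroup V] [Module ℂ V]
  {K : (Fin n → ℤ) → Module.End ℂ V} {E F : Fin (n - 1) → Module.End ℂ V}

theorem tensor_relations (N : ℕ) (h : UqRelations n r K E F) :
    UqRelations n r
      (fun m => tmap (N := N) fun _ => K m)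
      (fun k => ∑ l : Fin N, siteOp (K (simpleRoot k)) (E k) (K (-simpleRoot k)) l)
      (fun k => ∑ l : Fin N, siteOp (K (simpleRoot k)) (F k) (K (-simpleRoot k)) l) := by
  have hr : (r : ℂ) ≠ 0 := r.ne_zero
  have KE : ∀ k l, K (simpleRoot k) * E l = (r : ℂ) ^ (pairing k l) • (E l * K (simpleRoot k)) :=
    fun k l => h.K_E _ _
  have KF : ∀ k l, K (simpleRoot k) * F l = (r : ℂ) ^ (-pairing k l) • (F l * K (simpleRoot k)) :=
    fun k l => h.K_F _ _
  have EK : ∀ k l, E l * K (-simpleRoot k) = (r : ℂ) ^ (pairing k l) • (K (-simpleRoot k) * E l) := by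
    intro k l
    rw [h.K_E, smul_smul, ← zpow_add₀ hr]
    simp [pairing]
  have FK : ∀ k l, F l * K (-simpleRoot k) = (r : ℂ) ^ (-pairing k l) • (K (-simpleRoot k) * F l) := by
    intro k l
    rw [h.K_F, smul_smul, ← zpow_add₀ hr]
    simp [pairing]
  have sEE : ∀ i j (l m : Fin N), l < m →
      siteOp (K (simpleRoot j)) (E j) (K (-simpleRoot j)) m
        * siteOp (K (simpleRoot i)) (E i) (K (-simpleRoot i)) l
      = ((r : ℂ) ^ (pairing i j) * (r : ℂ) ^ (pairing i j)) •
        (siteOp (K (simpleRoot i)) (E i) (K (-simpleRoot i)) l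
          * siteOp (K (simpleRoot j)) (E j) (K (-simpleRoot j)) m) := fun i j l m hlm =>
    siteOp_mul_siteOp hlm (h.K_comm _ _) (pairing_symm i j ▸ KE j i) (h.K_comm _ _) (EK i j)
      (h.K_comm _ _)
  have sFF : ∀ i j (l m : Fin N), l < m →
      siteOp (K (simpleRoot j)) (F j) (K (-simpleRoot j)) m
        * siteOp (K (simpleRoot i)) (F i) (K (-simpleRoot i)) l
      = ((r : ℂ) ^ (-pairing i j) * (r : ℂ) ^ (-pairing i j)) •
        (siteOp (K (simpleRoot i)) (F i) (K (-simpleRoot i)) l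
          * siteOp (K (simpleRoot j)) (F j) (K (-simpleRoot j)) m) := fun i j l m hlm =>
    siteOp_mul_siteOp hlm (h.K_comm _ _) (pairing_symm i j ▸ KF j i) (h.K_comm _ _) (FK i j)
      (h.K_comm _ _)
  have sEF : ∀ i j (l m : Fin N), l ≠ m →
      siteOp (K (simpleRoot i)) (E i) (K (-simpleRoot i)) l
          * siteOp (K (simpleRoot j)) (F j) (K (-simpleRoot j)) m
      = siteOp (K (simpleRoot j)) (F j) (K (-simpleRoot j)) m
        * siteOp (K (simpleRoot i)) (E i) (K (-simpleRoot i)) l := by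
    intro i j l m hlm
    rcases lt_or_gt_of_ne hlm with hlm | hlm
    · have := siteOp_mul_siteOp hlm (h.K_comm (simpleRoot j) (simpleRoot i))
        (pairing_symm i j ▸ KE j i) (h.K_comm _ (-simpleRoot i)) (FK i j)
        (h.K_comm (-simpleRoot j) _)
      rw [this, ← zpow_add₀ hr, add_neg_cancel, zpow_zero, one_smul]
    · have := siteOp_mul_siteOp hlm (h.K_comm (simpleRoot i) (simpleRoot j))
        (KF i j) (h.K_comm _ (-simpleRoot j)) (pairing_symm i j ▸ EK j i)
        (h.K_comm (-simpleRoot i) _)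
      rw [this, ← zpow_add₀ hr, neg_add_cancel, zpow_zero, one_smul]
  have serre_site : ∀ (X : Fin (n - 1) → Module.End ℂ V) (i j : Fin (n - 1)) (l : Fin N),
      X i * X i * X j - ((r : ℂ) ^ 2 + ((r : ℂ) ^ 2)⁻¹) • (X i * X j * X i) + X j * X i * X i = 0 →
      let S := fun k => siteOp (K (simpleRoot k)) (X k) (K (-simpleRoot k)) l
      S i * S i * S j - ((r : ℂ) ^ 2 + ((r : ℂ) ^ 2)⁻¹) • (S i * S j * S i) + S j * S i * S i = 0 := by
    intro X i j l hX S
    have e1 : K (simpleRoot i) * K (simpleRoot j) * K (simpleRoot i)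
        = K (simpleRoot i) * K (simpleRoot i) * K (simpleRoot j) := by
      rw [mul_assoc, h.K_comm (simpleRoot j), mul_assoc]
    have e2 : K (simpleRoot j) * K (simpleRoot i) * K (simpleRoot i)
        = K (simpleRoot i) * K (simpleRoot i) * K (simpleRoot j) := by
      rw [h.K_comm (simpleRoot j), e1]
    have e3 : K (-simpleRoot i) * K (-simpleRoot j) * K (-simpleRoot i)
        = K (-simpleRoot i) * K (-simpleRoot i) * K (-simpleRoot j) := by
      rw [mul_assoc, h.K_comm (-simpleRoot j), mul_assoc]
    have e4 : K (-simpleRoot j) * K (-simpleRoot i) * K (-simpleRoot i)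
        = K (-simpleRoot i) * K (-simpleRoot i) * K (-simpleRoot j) := by
      rw [h.K_comm (-simpleRoot j), e3]
    simp only [S, siteOp_mul_same, e1, e2, e3, e4]
    rw [← siteOp_smul, ← siteOp_sub, ← siteOp_add, hX, siteOp_zero]
  refine ⟨?_, ?_, ?_, ?_, ?_, ?_, ?_, ?_, ?_, ?_⟩
  · simp only [h.K_zero]
    exact tmap_one
  · intro l m
    simp only [h.K_add, tmap_mul]
  · intro m k
    simp only [Finset.mul_sum, Finset.sum_mul, Finset.smul_sum]
    exact Finset.sum_congr rfl fun l _ =>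
      tmap_mul_siteOp (h.K_comm _ _) (h.K_E _ _) (h.K_comm _ _)
  · intro m k
    simp only [Finset.mul_sum, Finset.sum_mul, Finset.smul_sum]
    exact Finset.sum_congr rfl fun l _ =>
      tmap_mul_siteOp (h.K_comm _ _) (h.K_F _ _) (h.K_comm _ _)
  · intro k
    rw [commutator_sum _ _ (sEF k k), ← sum_siteOp_sub, Finset.smul_sum]
    refine Finset.sum_congr rfl fun l _ => ?_
    rw [siteOp_mul_same, siteOp_mul_same, ← siteOp_sub, ← siteOp_smul, h.E_F, siteOp_sub,
      ← h.K_add, ← h.K_add, neg_add]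
  · intro i j hij
    rw [← sub_eq_zero, commutator_sum _ _ (sEF i j)]
    refine Finset.sum_eq_zero fun l _ => ?_
    rw [siteOp_mul_same, siteOp_mul_same, h.K_comm (simpleRoot j), h.K_comm (-simpleRoot j),
      h.E_F_ne i j hij, sub_self]
  · intro i j hij
    refine serre_sum _ (pow_ne_zero 2 hr) _ _ ?_ ?_ ?_ ?_
    · intro l m hlm
      rw [sEE i i l m hlm, pairing_self, zpow_mul_zpow_two]
    · intro l m hlm
      rw [sEE i j l m hlm, pairing_adj i j hij, zpow_mul_zpow_neg]
    · intro l m hlm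
      rw [sEE j i l m hlm, pairing_adj j i hij.symm, zpow_mul_zpow_neg]
    · exact fun l => serre_site E i j l (h.serre_E i j hij)
  · intro i j hij
    have key : ((r : ℂ) ^ 2 + ((r : ℂ) ^ 2)⁻¹) = (((r : ℂ) ^ 2)⁻¹ + (((r : ℂ) ^ 2)⁻¹)⁻¹) := by
      rw [inv_inv, add_comm]
    rw [key]
    refine serre_sum _ (inv_ne_zero (pow_ne_zero 2 hr)) _ _ ?_ ?_ ?_ ?_
    · intro l m hlm
      rw [sFF i i l m hlm, pairing_self, zpow_mul_zpow_neg_two]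
    · intro l m hlm
      rw [sFF i j l m hlm, pairing_adj i j hij, inv_inv, zpow_mul_zpow_one]
    · intro l m hlm
      rw [sFF j i l m hlm, pairing_adj j i hij.symm, inv_inv, zpow_mul_zpow_one]
    · rw [← key]
      exact fun l => serre_site F i j l (h.serre_F i j hij)
  · intro i j hij
    rw [← sub_eq_zero, commutator_sum]
    · refine Finset.sum_eq_zero fun l _ => ?_
      rw [siteOp_mul_same, siteOp_mul_same, h.K_comm (simpleRoot j), h.K_comm (-simpleRoot j),
        h.comm_E i j hij, sub_self]
    · intro l m hlm
      rcases lt_or_gt_of_ne hlm with hlm | hlm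
      · rw [sEE i j l m hlm, pairing_far i j hij]; simp
      · rw [sEE j i m l hlm, pairing_far j i hij.symm]; simp
  · intro i j hij
    rw [← sub_eq_zero, commutator_sum]
    · refine Finset.sum_eq_zero fun l _ => ?_
      rw [siteOp_mul_same, siteOp_mul_same, h.K_comm (simpleRoot j), h.K_comm (-simpleRoot j),
        h.comm_F i j hij, sub_self]
    · intro l m hlm
      rcases lt_or_gt_of_ne hlm with hlm | hlm
      · rw [sFF i j l m hlm, pairing_far i j hij]; simp
      · rw [sFF j i m l hlm, pairing_far j i hij.symm]; simp

/-- The `N`-fold tensor power of a representation with respect to the coproduct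
`Δ(q^λ) = q^λ ⊗ q^λ`, `Δ(e_k) = e_k ⊗ q^{-(ε_k - ε_{k+1})/2} + q^{(ε_k - ε_{k+1})/2} ⊗ e_k`, and the same
for `f_k`: on `V^{⊗N}`, `q^λ` acts by `q^λ ⊗ ⋯ ⊗ q^λ`, and `e_k` by
`∑_l q^{(ε_k - ε_{k+1})/2} ⊗ ⋯ ⊗ e_k ⊗ ⋯ ⊗ q^{-(ε_k - ε_{k+1})/2}` with `e_k` in position `l`. -/
noncomputable def tensorRep (N : ℕ) (σ : Uq n r →ₐ[ℂ] Module.End ℂ V) :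
    Uq n r →ₐ[ℂ] Module.End ℂ (⨂[ℂ] _ : Fin N, V) :=
  Uq.lift (tensor_relations N ((Uq.relations n r).map σ))

end

/-- The free generators. -/
noncomputable abbrev genx {n : ℕ} (i j : Fin n) : FreeAlgebra ℂ (Fin n × Fin n) :=
  FreeAlgebra.ι ℂ (i, j)

/-- The defining relations of the quantum matrix algebra. -/
inductive AqRel (n : ℕ) (q : ℂ) :
    FreeAlgebra ℂ (Fin n × Fin n) → FreeAlgebra ℂ (Fin n × Fin n) → Prop
  | col (i j k : Fin n) (hij : i < j) :
      AqRel n q (genx i k * genx j k) (q • (genx j k * genx i k))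
  | row (k i j : Fin n) (hij : i < j) :
      AqRel n q (genx k i * genx k j) (q • (genx k j * genx k i))
  | anti (i j k l : Fin n) (hij : i < j) (hkl : k < l) :
      AqRel n q (genx i l * genx j k) (genx j k * genx i l)
  | diag (i j k l : Fin n) (hij : i < j) (hkl : k < l) :
      AqRel n q (genx i k * genx j l - genx j l * genx i k)
        ((q - q⁻¹) • (genx i l * genx j k))

/-- The quantum matrix algebra `A_q(Mat_n)`. -/
abbrev Aq (n : ℕ) (q : ℂ) : Type := RingQuot (AqRel n q)

namespace Aq

variable {n : ℕ} {q : ℂ}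

/-- The generator `x_{ij}`. -/
noncomputable def x (q : ℂ) (i j : Fin n) : Aq n q :=
  RingQuot.mkAlgHom ℂ (AqRel n q) (genx i j)

theorem col {i j : Fin n} (hij : i < j) (k : Fin n) :
    x q i k * x q j k = q • (x q j k * x q i k) := by
  simpa only [x, map_mul, map_smul] using RingQuot.mkAlgHom_rel ℂ (AqRel.col (q := q) i j k hij)

theorem row {i j : Fin n} (hij : i < j) (k : Fin n) :
    x q k i * x q k j = q • (x q k j * x q k i) := by
  simpa only [x, map_mul, map_smul] using RingQuot.mkAlgHom_rel ℂ (AqRel.row (q := q) k i j hij)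

theorem anti {i j k l : Fin n} (hij : i < j) (hkl : k < l) :
    x q i l * x q j k = x q j k * x q i l := by
  simpa only [x, map_mul] using RingQuot.mkAlgHom_rel ℂ (AqRel.anti (q := q) i j k l hij hkl)

theorem diag {i j k l : Fin n} (hij : i < j) (hkl : k < l) :
    x q i k * x q j l - x q j l * x q i k = (q - q⁻¹) • (x q i l * x q j k) := by
  simpa only [x, map_mul, map_sub, map_smul] using
    RingQuot.mkAlgHom_rel ℂ (AqRel.diag (q := q) i j k l hij hkl)

noncomputable def lift {R : Type*} [Ring R] [Algebra ℂ R] (X : Fin n → Fin n → R)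
    (h1 : ∀ i j k, i < j → X i k * X j k = q • (X j k * X i k))
    (h2 : ∀ k i j, i < j → X k i * X k j = q • (X k j * X k i))
    (h3 : ∀ i j k l, i < j → k < l → X i l * X j k = X j k * X i l)
    (h4 : ∀ i j k l, i < j → k < l →
      X i k * X j l - X j l * X i k = (q - q⁻¹) • (X i l * X j k)) :
    Aq n q →ₐ[ℂ] R :=
  RingQuot.liftAlgHom ℂ ⟨FreeAlgebra.lift ℂ fun p => X p.1 p.2, by
    intro a b hab
    cases hab with
    | col i j k hij => simpa only [map_mul, map_smul, FreeAlgebra.lift_ι_apply] using h1 i j k hij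
    | row k i j hij => simpa only [map_mul, map_smul, FreeAlgebra.lift_ι_apply] using h2 k i j hij
    | anti i j k l hij hkl =>
      simpa only [map_mul, FreeAlgebra.lift_ι_apply] using h3 i j k l hij hkl
    | diag i j k l hij hkl =>
      simpa only [map_mul, map_sub, map_smul, FreeAlgebra.lift_ι_apply] using
        h4 i j k l hij hkl⟩

theorem lift_x {R : Type*} [Ring R] [Algebra ℂ R] (X : Fin n → Fin n → R) (h1 h2 h3 h4)
    (i j : Fin n) : lift (q := q) X h1 h2 h3 h4 (x q i j) = X i j := by
  simp [lift, x]

theorem induction {P : Aq n q → Prop} (hC : ∀ c : ℂ, P (algebraMap ℂ _ c))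
    (hx : ∀ i j, P (x q i j)) (hmul : ∀ a b, P a → P b → P (a * b))
    (hadd : ∀ a b, P a → P b → P (a + b)) (a : Aq n q) : P a := by
  obtain ⟨a, rfl⟩ := RingQuot.mkAlgHom_surjective ℂ (AqRel n q) a
  induction a using FreeAlgebra.induction with
  | grade0 c => simpa using hC c
  | grade1 p => exact hx p.1 p.2
  | mul a b ha hb => rw [map_mul]; exact hmul _ _ ha hb
  | add a b ha hb => rw [map_add]; exact hadd _ _ ha hb

end Aq

section rules
variable {n : ℕ} {q : ℂ}

theorem rule_col (hq : q ≠ 0) {i j : Fin n} (hij : i < j) (k : Fin n) :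
    Aq.x q j k * Aq.x q i k = q⁻¹ • (Aq.x q i k * Aq.x q j k) := by
  rw [Aq.col hij, smul_smul, inv_mul_cancel₀ hq, one_smul]

theorem rule_row (hq : q ≠ 0) {i j : Fin n} (hij : i < j) (k : Fin n) :
    Aq.x q k j * Aq.x q k i = q⁻¹ • (Aq.x q k i * Aq.x q k j) := by
  rw [Aq.row hij, smul_smul, inv_mul_cancel₀ hq, one_smul]

theorem rule_anti {i j k l : Fin n} (hij : i < j) (hkl : k < l) :
    Aq.x q j k * Aq.x q i l = Aq.x q i l * Aq.x q j k := (Aq.anti hij hkl).symm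

theorem rule_diag {i j k l : Fin n} (hij : i < j) (hkl : k < l) :
    Aq.x q j l * Aq.x q i k
      = Aq.x q i k * Aq.x q j l - (q - q⁻¹) • (Aq.x q i l * Aq.x q j k) := by
  rw [← Aq.diag hij hkl, sub_sub_cancel]

end rules

section Action

variable {n : ℕ} (r : ℂˣ)

/-- The action of `q^λ` (`λ = m / 2`): the algebra automorphism `x_{ij} ↦ q^{⟨λ, ε_j⟩} x_{ij}`. -/
noncomputable def torus (m : Fin n → ℤ) : Aq n ((r : ℂ) ^ 2) →ₐ[ℂ] Aq n ((r : ℂ) ^ 2) :=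
  Aq.lift (fun i j => ((r : ℂ) ^ (m j)) • Aq.x _ i j)
    (by
      intro i j k hij
      simp only [smul_mul_smul_comm, Aq.col hij k]
      module)
    (by
      intro k i j hij
      simp only [smul_mul_smul_comm, Aq.row hij k]
      module)
    (by
      intro i j k l hij hkl
      simp only [smul_mul_smul_comm, Aq.anti hij hkl]
      module)
    (by
      intro i j k l hij hkl
      simp only [smul_mul_smul_comm, rule_diag hij hkl]
      module)

@[simp] theorem torus_x (m : Fin n → ℤ) (i j : Fin n) :
    torus r m (Aq.x _ i j) = ((r : ℂ) ^ (m j)) • Aq.x _ i j :=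
  Aq.lift_x _ _ _ _ _ i j

/-- The image of `x_{ij}` under `a ↦ (K a, X a; 0, K⁻¹ a)`, where `K` is the action of
`q^{(ε_k - ε_{k+1})/2}` and `X x_{ij} = δ_{jc} x_{id}`. -/
noncomputable def shiftMat (k : Fin (n - 1)) (c d i j : Fin n) :
    Matrix (Fin 2) (Fin 2) (Aq n ((r : ℂ) ^ 2)) :=
  !![((r : ℂ) ^ (simpleRoot k j)) • Aq.x _ i j, if j = c then Aq.x _ i d else 0;
    0, ((r : ℂ) ^ (-simpleRoot k j)) • Aq.x _ i j]

theorem upper_mul {R : Type*} [Ring R] (a b c a' b' c' : R) :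
    !![a, b; 0, c] * !![a', b'; 0, c'] = !![a * a', a * b' + b * c'; 0, c * c'] := by
  simp

theorem upper_smul {R : Type*} [Ring R] [Algebra ℂ R] (t : ℂ) (a b c : R) :
    t • !![a, b; 0, c] = !![t • a, t • b; 0, t • c] := by
  simp

theorem upper_sub {R : Type*} [Ring R] (a b c a' b' c' : R) :
    !![a, b; 0, c] - !![a', b'; 0, c'] = !![a - a', b - b'; 0, c - c'] := by
  ext i j
  fin_cases i <;> fin_cases j <;> simp

theorem upper_ext {R : Type*} [Ring R] {a b c a' b' c' : R} (h1 : a = a') (h2 : b = b')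
    (h3 : c = c') : !![a, b; 0, c] = !![a', b'; 0, c'] := by
  rw [h1, h2, h3]

theorem simpleRoot_lo (k : Fin (n - 1)) : simpleRoot k (lo k) = 1 := by
  simp [simpleRoot, lo_ne_hi]

theorem simpleRoot_hi (k : Fin (n - 1)) : simpleRoot k (hi k) = -1 := by
  simp [simpleRoot, (lo_ne_hi k).symm]

theorem simpleRoot_of_ne (k : Fin (n - 1)) {j : Fin n} (h1 : j ≠ lo k) (h2 : j ≠ hi k) :
    simpleRoot k j = 0 := by
  simp [simpleRoot, h1, h2]

theorem lo_lt_hi (k : Fin (n - 1)) : lo k < hi k := by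
  simp [lo, hi, Fin.lt_def]

theorem lt_lo_of_lt_hi {k : Fin (n - 1)} {j : Fin n} (h : j < hi k) (h' : j ≠ lo k) :
    j < lo k := by
  simp only [lo, hi, Fin.lt_def, Fin.ext_iff, ne_eq] at *; omega

theorem hi_lt_of_lo_lt {k : Fin (n - 1)} {j : Fin n} (h : lo k < j) (h' : j ≠ hi k) :
    hi k < j := by
  simp only [lo, hi, Fin.lt_def, Fin.ext_iff, ne_eq] at *; omega

theorem shift_col (k : Fin (n - 1)) {c d : Fin n}
    (hcd : (c = hi k ∧ d = lo k) ∨ (c = lo k ∧ d = hi k)) (i j l : Fin n) (hij : i < j) :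
    shiftMat r k c d i l * shiftMat r k c d j l
      = ((r : ℂ) ^ 2) • (shiftMat r k c d j l * shiftMat r k c d i l) := by
  have hr : (r : ℂ) ≠ 0 := r.ne_zero
  have hq : (r : ℂ) ^ 2 ≠ 0 := pow_ne_zero 2 hr
  have hlh := lo_lt_hi k
  simp only [shiftMat, upper_mul, upper_smul]
  refine upper_ext ?_ ?_ ?_
  · simp only [smul_mul_smul_comm, rule_col hq hij]
    match_scalars; field_simp
  · rcases hcd with ⟨rfl, rfl⟩ | ⟨rfl, rfl⟩
    · by_cases h : l = hi k
      · subst h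
        simp only [simpleRoot_hi, if_true, neg_neg, neg_zero, zpow_zero, zpow_one,
            zpow_neg_one, one_smul, smul_mul_assoc, mul_smul_comm,
          rule_anti hij hlh, rule_diag hij hlh]
        match_scalars <;> field_simp <;> ring
      · simp [h]
    · by_cases h : l = lo k
      · subst h
        simp only [simpleRoot_lo, if_true, neg_neg, neg_zero, zpow_zero, zpow_one,
            zpow_neg_one, one_smul, smul_mul_assoc, mul_smul_comm,
          rule_anti hij hlh, rule_diag hij hlh]
        match_scalars <;> field_simp <;> ring
      · simp [h]
  · simp only [smul_mul_smul_comm, rule_col hq hij]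
    match_scalars; field_simp

theorem shift_row (k : Fin (n - 1)) {c d : Fin n}
    (hcd : (c = hi k ∧ d = lo k) ∨ (c = lo k ∧ d = hi k)) (i l m : Fin n) (hlm : l < m) :
    shiftMat r k c d i l * shiftMat r k c d i m
      = ((r : ℂ) ^ 2) • (shiftMat r k c d i m * shiftMat r k c d i l) := by
  have hr : (r : ℂ) ≠ 0 := r.ne_zero
  have hq : (r : ℂ) ^ 2 ≠ 0 := pow_ne_zero 2 hr
  have hlh := lo_lt_hi k
  simp only [shiftMat, upper_mul, upper_smul]
  refine upper_ext ?_ ?_ ?_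
  · simp only [smul_mul_smul_comm, rule_row hq hlm]
    match_scalars; field_simp
  · rcases hcd with ⟨rfl, rfl⟩ | ⟨rfl, rfl⟩
    · by_cases h : m = hi k
      · subst h
        by_cases h' : l = lo k
        · subst h'
          simp only [simpleRoot_lo, simpleRoot_hi, if_true, neg_neg, neg_zero, zpow_zero, zpow_one,
            zpow_neg_one, one_smul, if_neg hlm.ne, smul_mul_assoc,
            mul_smul_comm, zero_mul, mul_zero]
          match_scalars <;> field_simp
        · have h2 := lt_lo_of_lt_hi hlm h'
          simp only [simpleRoot_of_ne k h' hlm.ne, simpleRoot_hi, if_true, neg_neg, neg_zero, zpow_zero, zpow_one,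
            zpow_neg_one, one_smul, if_neg hlm.ne,
            smul_mul_assoc, mul_smul_comm, zero_mul, mul_zero, rule_row hq h2]
          match_scalars <;> field_simp
      · by_cases h' : l = hi k
        · subst h'
          have h2 := hlh.trans hlm
          simp only [simpleRoot_of_ne k h2.ne' h, if_true, neg_neg, neg_zero, zpow_zero, zpow_one,
            zpow_neg_one, one_smul, if_neg h,
            smul_mul_assoc, mul_smul_comm, zero_mul, mul_zero, rule_row hq h2]
          match_scalars <;> field_simp
        · simp [h, h']
    · by_cases h : l = lo k
      · subst h
        by_cases h' : m = hi k
        · subst h'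
          simp only [simpleRoot_lo, simpleRoot_hi, if_true, neg_neg, neg_zero, zpow_zero, zpow_one,
            zpow_neg_one, one_smul, if_neg hlm.ne', smul_mul_assoc,
            mul_smul_comm, zero_mul, mul_zero]
          match_scalars <;> field_simp
        · have h2 := hi_lt_of_lo_lt hlm h'
          simp only [simpleRoot_of_ne k hlm.ne' h', simpleRoot_lo, if_true, neg_neg, neg_zero, zpow_zero, zpow_one,
            zpow_neg_one, one_smul, if_neg hlm.ne',
            smul_mul_assoc, mul_smul_comm, zero_mul, mul_zero, rule_row hq h2]
          match_scalars <;> field_simp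
      · by_cases h' : m = lo k
        · subst h'
          have h2 := hlm.trans hlh
          simp only [simpleRoot_of_ne k h h2.ne, if_true, neg_neg, neg_zero, zpow_zero, zpow_one,
            zpow_neg_one, one_smul, if_neg h,
            smul_mul_assoc, mul_smul_comm, zero_mul, mul_zero, rule_row hq h2]
          match_scalars <;> field_simp
        · simp [h, h']
  · simp only [smul_mul_smul_comm, rule_row hq hlm]
    match_scalars; field_simp

theorem shift_anti (k : Fin (n - 1)) {c d : Fin n}
    (hcd : (c = hi k ∧ d = lo k) ∨ (c = lo k ∧ d = hi k)) (i j l m : Fin n) (hij : i < j)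
    (hlm : l < m) :
    shiftMat r k c d i m * shiftMat r k c d j l
      = shiftMat r k c d j l * shiftMat r k c d i m := by
  have hr : (r : ℂ) ≠ 0 := r.ne_zero
  have hq : (r : ℂ) ^ 2 ≠ 0 := pow_ne_zero 2 hr
  have hlh := lo_lt_hi k
  simp only [shiftMat, upper_mul, upper_smul]
  refine upper_ext ?_ ?_ ?_
  · simp only [smul_mul_smul_comm, rule_anti hij hlm]
    match_scalars; ring
  · rcases hcd with ⟨rfl, rfl⟩ | ⟨rfl, rfl⟩
    · by_cases h : m = hi k
      · subst h
        by_cases h' : l = lo k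
        · subst h'
          simp only [simpleRoot_lo, simpleRoot_hi, if_true, neg_neg, neg_zero, zpow_zero, zpow_one,
            zpow_neg_one, one_smul, if_neg hlm.ne, smul_mul_assoc,
            mul_smul_comm, zero_mul, mul_zero, rule_col hq hij]
          match_scalars <;> field_simp
        · have h2 := lt_lo_of_lt_hi hlm h'
          simp only [simpleRoot_of_ne k h' hlm.ne, simpleRoot_hi, if_true, neg_neg, neg_zero, zpow_zero, zpow_one,
            zpow_neg_one, one_smul, if_neg hlm.ne,
            smul_mul_assoc, mul_smul_comm, zero_mul, mul_zero, rule_anti hij h2]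
          match_scalars <;> field_simp
      · by_cases h' : l = hi k
        · subst h'
          have h2 := hlh.trans hlm
          simp only [simpleRoot_of_ne k h2.ne' h, if_true, neg_neg, neg_zero, zpow_zero, zpow_one,
            zpow_neg_one, one_smul, if_neg h,
            smul_mul_assoc, mul_smul_comm, zero_mul, mul_zero, rule_anti hij h2]
          match_scalars <;> field_simp
        · simp [h, h']
    · by_cases h : l = lo k
      · subst h
        by_cases h' : m = hi k
        · subst h'
          simp only [simpleRoot_lo, simpleRoot_hi, if_true, neg_neg, neg_zero, zpow_zero, zpow_one,
            zpow_neg_one, one_smul, if_neg hlm.ne', smul_mul_assoc,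
            mul_smul_comm, zero_mul, mul_zero, rule_col hq hij]
          match_scalars <;> field_simp
        · have h2 := hi_lt_of_lo_lt hlm h'
          simp only [simpleRoot_of_ne k hlm.ne' h', simpleRoot_lo, if_true, neg_neg, neg_zero, zpow_zero, zpow_one,
            zpow_neg_one, one_smul, if_neg hlm.ne',
            smul_mul_assoc, mul_smul_comm, zero_mul, mul_zero, rule_anti hij h2]
          match_scalars <;> field_simp
      · by_cases h' : m = lo k
        · subst h'
          have h2 := hlm.trans hlh
          simp only [simpleRoot_of_ne k h h2.ne, if_true, neg_neg, neg_zero, zpow_zero, zpow_one,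
            zpow_neg_one, one_smul, if_neg h,
            smul_mul_assoc, mul_smul_comm, zero_mul, mul_zero, rule_anti hij h2]
          match_scalars <;> field_simp
        · simp [h, h']
  · simp only [smul_mul_smul_comm, rule_anti hij hlm]
    match_scalars; ring

theorem shift_diag (k : Fin (n - 1)) {c d : Fin n}
    (hcd : (c = hi k ∧ d = lo k) ∨ (c = lo k ∧ d = hi k)) (i j l m : Fin n) (hij : i < j)
    (hlm : l < m) :
    shiftMat r k c d i l * shiftMat r k c d j m - shiftMat r k c d j m * shiftMat r k c d i l
      = ((r : ℂ) ^ 2 - ((r : ℂ) ^ 2)⁻¹) •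
        (shiftMat r k c d i m * shiftMat r k c d j l) := by
  have hr : (r : ℂ) ≠ 0 := r.ne_zero
  have hq : (r : ℂ) ^ 2 ≠ 0 := pow_ne_zero 2 hr
  have hlh := lo_lt_hi k
  simp only [shiftMat, upper_mul, upper_smul, upper_sub]
  refine upper_ext ?_ ?_ ?_
  · simp only [smul_mul_smul_comm, rule_diag hij hlm]
    module
  · rcases hcd with ⟨rfl, rfl⟩ | ⟨rfl, rfl⟩
    · by_cases h : m = hi k
      · subst h
        by_cases h' : l = lo k
        · subst h'
          simp only [simpleRoot_lo, simpleRoot_hi, if_true, neg_neg, neg_zero, zpow_zero, zpow_one,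
            zpow_neg_one, one_smul, if_neg hlm.ne, smul_mul_assoc,
            mul_smul_comm, zero_mul, mul_zero, rule_col hq hij]
          match_scalars <;> field_simp
        · have h2 := lt_lo_of_lt_hi hlm h'
          simp only [simpleRoot_of_ne k h' hlm.ne, simpleRoot_hi, if_true, neg_neg, neg_zero, zpow_zero, zpow_one,
            zpow_neg_one, one_smul, if_neg hlm.ne,
            smul_mul_assoc, mul_smul_comm, zero_mul, mul_zero, rule_diag hij h2]
          match_scalars <;> field_simp <;> ring
      · by_cases h' : l = hi k
        · subst h'
          have h2 := hlh.trans hlm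
          simp only [simpleRoot_of_ne k h2.ne' h, if_true, neg_neg, neg_zero, zpow_zero, zpow_one,
            zpow_neg_one, one_smul, if_neg h,
            smul_mul_assoc, mul_smul_comm, zero_mul, mul_zero, rule_diag hij h2]
          match_scalars <;> field_simp <;> ring
        · simp [h, h']
    · by_cases h : l = lo k
      · subst h
        by_cases h' : m = hi k
        · subst h'
          simp only [simpleRoot_lo, simpleRoot_hi, if_true, neg_neg, neg_zero, zpow_zero, zpow_one,
            zpow_neg_one, one_smul, if_neg hlm.ne', smul_mul_assoc,
            mul_smul_comm, zero_mul, mul_zero, rule_col hq hij]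
          match_scalars <;> field_simp
        · have h2 := hi_lt_of_lo_lt hlm h'
          simp only [simpleRoot_of_ne k hlm.ne' h', simpleRoot_lo, if_true, neg_neg, neg_zero, zpow_zero, zpow_one,
            zpow_neg_one, one_smul, if_neg hlm.ne',
            smul_mul_assoc, mul_smul_comm, zero_mul, mul_zero, rule_diag hij h2]
          match_scalars <;> field_simp <;> ring
      · by_cases h' : m = lo k
        · subst h'
          have h2 := hlm.trans hlh
          simp only [simpleRoot_of_ne k h h2.ne, if_true, neg_neg, neg_zero, zpow_zero, zpow_one,
            zpow_neg_one, one_smul, if_neg h,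
            smul_mul_assoc, mul_smul_comm, zero_mul, mul_zero, rule_diag hij h2]
          match_scalars <;> field_simp <;> ring
        · simp [h, h']
  · simp only [smul_mul_smul_comm, rule_diag hij hlm]
    module

noncomputable def shiftHom (k : Fin (n - 1)) {c d : Fin n}
    (hcd : (c = hi k ∧ d = lo k) ∨ (c = lo k ∧ d = hi k)) :
    Aq n ((r : ℂ) ^ 2) →ₐ[ℂ] Matrix (Fin 2) (Fin 2) (Aq n ((r : ℂ) ^ 2)) :=
  Aq.lift (shiftMat r k c d) (shift_col r k hcd) (shift_row r k hcd) (shift_anti r k hcd)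
    (shift_diag r k hcd)

/-- The operator `X` on the quantum matrix algebra with `X x_{ij} = δ_{jc} x_{id}`, `X 1 = 0` and
`X (a b) = (X a) (K⁻¹ b) + (K a) (X b)` (see `shiftOp_x`, `shiftOp_mul`). -/
noncomputable def shiftOp (k : Fin (n - 1)) {c d : Fin n}
    (hcd : (c = hi k ∧ d = lo k) ∨ (c = lo k ∧ d = hi k)) :
    Module.End ℂ (Aq n ((r : ℂ) ^ 2)) :=
  (Matrix.entryLinearMap ℂ (Aq n ((r : ℂ) ^ 2)) 0 1) ∘ₗ (shiftHom r k hcd).toLinearMap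

section shift

variable (k : Fin (n - 1)) {c d : Fin n}
    (hcd : (c = hi k ∧ d = lo k) ∨ (c = lo k ∧ d = hi k))

theorem shiftHom_eq (a : Aq n ((r : ℂ) ^ 2)) :
    shiftHom r k hcd a = !![torus r (simpleRoot k) a, shiftOp r k hcd a;
      0, torus r (-simpleRoot k) a] := by
  have key : shiftHom r k hcd a 0 0 = torus r (simpleRoot k) a ∧
      shiftHom r k hcd a 1 0 = 0 ∧
      shiftHom r k hcd a 1 1 = torus r (-simpleRoot k) a := by
    induction a using Aq.induction with
    | hC t => simp [Algebra.algebraMap_eq_smul_one]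
    | hx i j => simp [shiftHom, Aq.lift_x, shiftMat]
    | hmul a b ha hb =>
      simp [Matrix.mul_apply, Fin.sum_univ_two, ha, hb]
    | hadd a b ha hb => simp [ha, hb]
  ext i j
  fin_cases i <;> fin_cases j
  · exact key.1
  · rfl
  · exact key.2.1
  · exact key.2.2

theorem shiftOp_mul (a b : Aq n ((r : ℂ) ^ 2)) :
    shiftOp r k hcd (a * b) = shiftOp r k hcd a * torus r (-simpleRoot k) b
      + torus r (simpleRoot k) a * shiftOp r k hcd b := by
  have h := congrFun (congrFun (map_mul (shiftHom r k hcd) a b) 0) 1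
  simp only [shiftHom_eq, upper_mul] at h
  simpa [add_comm] using h

theorem shiftOp_algebraMap (t : ℂ) : shiftOp r k hcd (algebraMap ℂ _ t) = 0 := by
  simp [shiftOp, Algebra.algebraMap_eq_smul_one]

theorem shiftOp_x (i j : Fin n) :
    shiftOp r k hcd (Aq.x _ i j) = if j = c then Aq.x _ i d else 0 := by
  simp [shiftOp, shiftHom, Aq.lift_x, shiftMat]

end shift

/-- The action of `e_k`: `x_{ij} ↦ δ_{j,k+1} x_{ik}`, extended to products by the coproduct. -/
noncomputable def eOp (k : Fin (n - 1)) : Module.End ℂ (Aq n ((r : ℂ) ^ 2)) :=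
  shiftOp r k (c := hi k) (d := lo k) (Or.inl ⟨rfl, rfl⟩)

/-- The action of `f_k`: `x_{ij} ↦ δ_{j,k} x_{i,k+1}`, extended to products by the coproduct. -/
noncomputable def fOp (k : Fin (n - 1)) : Module.End ℂ (Aq n ((r : ℂ) ^ 2)) :=
  shiftOp r k (c := lo k) (d := hi k) (Or.inr ⟨rfl, rfl⟩)

theorem end_ext {n : ℕ} {q : ℂ} (S T : Module.End ℂ (Aq n q))
    (hC : ∀ t : ℂ, S (algebraMap ℂ _ t) = T (algebraMap ℂ _ t))
    (hx : ∀ i j, S (Aq.x q i j) = T (Aq.x q i j))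
    (hmul : ∀ a b, S a = T a → S b = T b → S (a * b) = T (a * b)) : S = T := by
  ext a
  induction a using Aq.induction with
  | hC t => exact hC t
  | hx i j => exact hx i j
  | hmul a b ha hb => exact hmul a b ha hb
  | hadd a b ha hb => rw [map_add, map_add, ha, hb]

end Action

theorem serre_mul {ι A : Type*} [Ring A] [Algebra ℂ A] (κ κ' : ι → Module.End ℂ A)
    (hκ : ∀ i j, κ i * κ j = κ j * κ i) (hκ' : ∀ i j, κ' i * κ' j = κ' j * κ' i)
    (c d e : ℂ) (hc : c ≠ 0) (hd : d * d = c ^ 2) (he : e * e = c⁻¹)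
    (X : ι → Module.End ℂ (A))
    (hX : ∀ k a b, X k (a * b) = X k a * κ' k b
      + κ k a * X k b) (i j : ι)
    (h1 : κ i * X i = d • (X i * κ i))
    (h2 : X i * κ' i = d • (κ' i * X i))
    (h3 : κ j * X i = e • (X i * κ j))
    (h4 : X j * κ' i = e • (κ' i * X j))
    (h5 : κ i * X j = e • (X j * κ i))
    (h6 : X i * κ' j = e • (κ' j * X i))
    (a b : A)
    (ha : (X i * X i * X j - (c + c⁻¹) • (X i * X j * X i) + X j * X i * X i) a = 0)
    (hb : (X i * X i * X j - (c + c⁻¹) • (X i * X j * X i) + X j * X i * X i) b = 0) :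
    (X i * X i * X j - (c + c⁻¹) • (X i * X j * X i) + X j * X i * X i) (a * b) = 0 := by
  let P : ι → Module.End ℂ (A ⊗[ℂ] A) := fun k =>
    TensorProduct.map (X k) (κ' k)
  let Q : ι → Module.End ℂ (A ⊗[ℂ] A) := fun k =>
    TensorProduct.map (κ k) (X k)
  let S : ι → Module.End ℂ (A ⊗[ℂ] A) := fun k => P k + Q k
  have hμ : ∀ k z, X k (LinearMap.mul' ℂ A z) = LinearMap.mul' ℂ A (S k z) := by
    intro k z
    induction z using TensorProduct.induction_on with
    | zero => simp
    | tmul a b => simp [S, P, Q, hX]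
    | add u v hu hv => simp only [map_add, hu, hv]
  have key := serre_add_eq c hc (P i) (Q i) (P j) (Q j)
    (by simp only [P, Q, ← TensorProduct.map_mul, h1, h2, TensorProduct.map_smul_left,
          TensorProduct.map_smul_right, smul_smul, hd])
    (by simp only [P, Q, ← TensorProduct.map_mul, h3, h4, TensorProduct.map_smul_left,
          TensorProduct.map_smul_right, smul_smul, he])
    (by simp only [P, Q, ← TensorProduct.map_mul, h5, h6, TensorProduct.map_smul_left,
          TensorProduct.map_smul_right, smul_smul, he])
  have e1 : ∀ μ : ι → Module.End ℂ A, (∀ i j, μ i * μ j = μ j * μ i) →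
      μ i * μ j * μ i = μ i * μ i * μ j := fun μ hμ => by
    rw [mul_assoc, hμ j, mul_assoc]
  have e2 : ∀ μ : ι → Module.End ℂ A, (∀ i j, μ i * μ j = μ j * μ i) →
      μ j * μ i * μ i = μ i * μ i * μ j := fun μ hμ => by
    rw [hμ j, e1 μ hμ]
  have hP : (P i * P i * P j - (c + c⁻¹) • (P i * P j * P i) + P j * P i * P i) (a ⊗ₜ b) = 0 := by
    simp only [P, ← TensorProduct.map_mul, e1 κ' hκ',
      e2 κ' hκ', ← TensorProduct.map_smul_left,
      LinearMap.add_apply, LinearMap.sub_apply, TensorProduct.map_tmul,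
      ← TensorProduct.sub_tmul, ← TensorProduct.add_tmul]
    rw [← LinearMap.sub_apply, ← LinearMap.add_apply, ha, TensorProduct.zero_tmul]
  have hQ : (Q i * Q i * Q j - (c + c⁻¹) • (Q i * Q j * Q i) + Q j * Q i * Q i) (a ⊗ₜ b) = 0 := by
    simp only [Q, ← TensorProduct.map_mul, e1 κ hκ,
      e2 κ hκ, ← TensorProduct.map_smul_right,
      LinearMap.add_apply, LinearMap.sub_apply, TensorProduct.map_tmul,
      ← TensorProduct.tmul_sub, ← TensorProduct.tmul_add]
    rw [← LinearMap.sub_apply, ← LinearMap.add_apply, hb, TensorProduct.tmul_zero]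
  have hz : LinearMap.mul' ℂ A ((S i * S i * S j - (c + c⁻¹) • (S i * S j * S i)
      + S j * S i * S i) (a ⊗ₜ b)) = 0 := by
    exact (congrArg (fun W : Module.End ℂ (A ⊗[ℂ] A) =>
      LinearMap.mul' ℂ A (W (a ⊗ₜ b))) key).trans <| (congrArg _ ((LinearMap.add_apply _ _ _).trans (by rw [hP, hQ, add_zero]))).trans
      (map_zero _)
  have hab : a * b = LinearMap.mul' ℂ A (a ⊗ₜ b) := (LinearMap.mul'_apply).symm
  rw [← hz, hab]
  simp only [LinearMap.add_apply, LinearMap.sub_apply, LinearMap.smul_apply,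
    Module.End.mul_apply, hμ, map_add, map_sub, map_smul]

section Action

variable {n : ℕ} (r : ℂˣ)

/-- The linear map `ℂ^n → A_q(Mat_n)`, `v_j ↦ x_{ij}`. -/
noncomputable def rowMap (i : Fin n) : (Fin n → ℂ) →ₗ[ℂ] Aq n ((r : ℂ) ^ 2) :=
  Fintype.linearCombination ℂ (fun j => Aq.x ((r : ℂ) ^ 2) i j)

theorem rowMap_single (i j : Fin n) : rowMap r i (Pi.single j 1) = Aq.x _ i j := by
  simp [rowMap, Fintype.linearCombination_apply, Pi.single_apply]

/-- The action of `q^λ` as a linear operator. -/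
noncomputable def torusOp (m : Fin n → ℤ) : Module.End ℂ (Aq n ((r : ℂ) ^ 2)) :=
  (torus r m).toLinearMap

theorem torus_rowMap (m : Fin n → ℤ) (i : Fin n) (v : Fin n → ℂ) :
    torusOp r m (rowMap r i v)
      = rowMap r i (Matrix.toLin' (Matrix.diagonal fun j => (r : ℂ) ^ (m j)) v) := by
  simp [torusOp, rowMap, Fintype.linearCombination_apply, Matrix.mulVec_diagonal, smul_smul,
    mul_comm]

theorem shiftOp_rowMap (k : Fin (n - 1)) {c d : Fin n}
    (hcd : (c = hi k ∧ d = lo k) ∨ (c = lo k ∧ d = hi k)) (i : Fin n) (v : Fin n → ℂ) :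
    shiftOp r k hcd (rowMap r i v)
      = rowMap r i (Matrix.toLin' (Matrix.single d c (1 : ℂ)) v) := by
  simp [rowMap, Fintype.linearCombination_apply, shiftOp_x, Matrix.single_mulVec,
    Function.update_apply]

theorem eq_on_x {S T : Module.End ℂ (Aq n ((r : ℂ) ^ 2))} {S' T' : Module.End ℂ (Fin n → ℂ)}
    (h : S' = T') (hS : ∀ i v, S (rowMap r i v) = rowMap r i (S' v))
    (hT : ∀ i v, T (rowMap r i v) = rowMap r i (T' v)) (i j : Fin n) :
    S (Aq.x _ i j) = T (Aq.x _ i j) := by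
  rw [← rowMap_single, hS, hT, h]

theorem eOp_rowMap (k : Fin (n - 1)) (i : Fin n) (v : Fin n → ℂ) :
    eOp r k (rowMap r i v)
      = rowMap r i (Matrix.toLin' (Matrix.single (lo k) (hi k) (1 : ℂ)) v) :=
  shiftOp_rowMap r k _ i v

theorem fOp_rowMap (k : Fin (n - 1)) (i : Fin n) (v : Fin n → ℂ) :
    fOp r k (rowMap r i v)
      = rowMap r i (Matrix.toLin' (Matrix.single (hi k) (lo k) (1 : ℂ)) v) :=
  shiftOp_rowMap r k _ i v

theorem torusOp_mul (m : Fin n → ℤ) (a b : Aq n ((r : ℂ) ^ 2)) :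
    torusOp r m (a * b) = torusOp r m a * torusOp r m b :=
  map_mul (torus r m) a b

theorem torusOp_algebraMap (m : Fin n → ℤ) (t : ℂ) :
    torusOp r m (algebraMap ℂ _ t) = algebraMap ℂ (Aq n ((r : ℂ) ^ 2)) t :=
  (torus r m).commutes t

theorem eOp_mul (k : Fin (n - 1)) (a b : Aq n ((r : ℂ) ^ 2)) :
    eOp r k (a * b) = eOp r k a * torusOp r (-simpleRoot k) b
      + torusOp r (simpleRoot k) a * eOp r k b :=
  shiftOp_mul r k _ a b

theorem fOp_mul (k : Fin (n - 1)) (a b : Aq n ((r : ℂ) ^ 2)) :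
    fOp r k (a * b) = fOp r k a * torusOp r (-simpleRoot k) b
      + torusOp r (simpleRoot k) a * fOp r k b :=
  shiftOp_mul r k _ a b

theorem eOp_algebraMap (k : Fin (n - 1)) (t : ℂ) :
    eOp r k (algebraMap ℂ (Aq n ((r : ℂ) ^ 2)) t) = 0 := shiftOp_algebraMap r k _ t

theorem fOp_algebraMap (k : Fin (n - 1)) (t : ℂ) :
    fOp r k (algebraMap ℂ (Aq n ((r : ℂ) ^ 2)) t) = 0 := shiftOp_algebraMap r k _ t

theorem torusOp_add (l m : Fin n → ℤ) : torusOp r (l + m) = torusOp r l * torusOp r m := by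
  refine end_ext _ _ (fun t => ?_) (fun i j => ?_) (fun a b ha hb => ?_)
  · simp only [Module.End.mul_apply, torusOp_algebraMap]
  · exact eq_on_x r ((vector_relations_end n r).K_add l m) (torus_rowMap r _)
      (fun i v => by simp only [Module.End.mul_apply, torus_rowMap]) i j
  · simp only [Module.End.mul_apply, torusOp_mul] at *
    rw [ha, hb]

theorem torusOp_comm (l m : Fin n → ℤ) :
    torusOp r l * torusOp r m = torusOp r m * torusOp r l := by
  rw [← torusOp_add, ← torusOp_add, add_comm]

theorem torusOp_comm_apply (l m : Fin n → ℤ) (a : Aq n ((r : ℂ) ^ 2)) :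
    torusOp r l (torusOp r m a) = torusOp r m (torusOp r l a) :=
  LinearMap.congr_fun (torusOp_comm r l m) a

theorem torusOp_eOp (m : Fin n → ℤ) (k : Fin (n - 1)) :
    torusOp r m * eOp r k = ((r : ℂ) ^ (m (lo k) - m (hi k))) • (eOp r k * torusOp r m) := by
  refine end_ext _ _ (fun t => ?_) (fun i j => ?_) (fun a b ha hb => ?_)
  · simp [Module.End.mul_apply, torusOp_algebraMap, eOp_algebraMap]
  · exact eq_on_x r ((vector_relations_end n r).K_E m k)
      (fun i v => by simp only [Module.End.mul_apply, torus_rowMap, eOp_rowMap])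
      (fun i v => by simp only [Module.End.mul_apply, torus_rowMap, eOp_rowMap,
        LinearMap.smul_apply, map_smul]) i j
  · simp only [Module.End.mul_apply, torusOp_mul, eOp_mul, map_add, LinearMap.smul_apply] at *
    rw [ha, hb, torusOp_comm_apply r m, torusOp_comm_apply r m, smul_add, smul_mul_assoc,
      mul_smul_comm]

theorem torusOp_fOp (m : Fin n → ℤ) (k : Fin (n - 1)) :
    torusOp r m * fOp r k = ((r : ℂ) ^ (-(m (lo k) - m (hi k)))) • (fOp r k * torusOp r m) := by
  refine end_ext _ _ (fun t => ?_) (fun i j => ?_) (fun a b ha hb => ?_)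
  · simp [Module.End.mul_apply, torusOp_algebraMap, fOp_algebraMap]
  · exact eq_on_x r ((vector_relations_end n r).K_F m k)
      (fun i v => by simp only [Module.End.mul_apply, torus_rowMap, fOp_rowMap])
      (fun i v => by simp only [Module.End.mul_apply, torus_rowMap, fOp_rowMap,
        LinearMap.smul_apply, map_smul]) i j
  · simp only [Module.End.mul_apply, torusOp_mul, fOp_mul, map_add, LinearMap.smul_apply] at *
    rw [ha, hb, torusOp_comm_apply r m, torusOp_comm_apply r m, smul_add, smul_mul_assoc,
      mul_smul_comm]

theorem aq_relations :
    UqRelations n r (torusOp (n := n) r) (eOp r) (fOp r) := by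
  have hr : (r : ℂ) ≠ 0 := r.ne_zero
  have KE : ∀ k l : Fin (n - 1), torusOp r (simpleRoot k) * eOp r l
      = (r : ℂ) ^ (pairing k l) • (eOp r l * torusOp r (simpleRoot k)) :=
    fun k l => torusOp_eOp r _ _
  have KF : ∀ k l : Fin (n - 1), torusOp r (simpleRoot k) * fOp r l
      = (r : ℂ) ^ (-pairing k l) • (fOp r l * torusOp r (simpleRoot k)) :=
    fun k l => torusOp_fOp r _ _
  have EK : ∀ k l : Fin (n - 1), eOp r l * torusOp r (-simpleRoot k)
      = (r : ℂ) ^ (pairing k l) • (torusOp r (-simpleRoot k) * eOp r l) := by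
    intro k l
    rw [torusOp_eOp, smul_smul, ← zpow_add₀ hr]
    simp [pairing]
  have FK : ∀ k l : Fin (n - 1), fOp r l * torusOp r (-simpleRoot k)
      = (r : ℂ) ^ (-pairing k l) • (torusOp r (-simpleRoot k) * fOp r l) := by
    intro k l
    rw [torusOp_fOp, smul_smul, ← zpow_add₀ hr]
    simp [pairing]
  have KEa : ∀ (k l : Fin (n - 1)) (a : Aq n ((r : ℂ) ^ 2)), torusOp r (simpleRoot k) (eOp r l a)
      = (r : ℂ) ^ (pairing k l) • (eOp r l (torusOp r (simpleRoot k) a)) :=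
    fun k l => LinearMap.congr_fun (KE k l)
  have KFa : ∀ (k l : Fin (n - 1)) (a : Aq n ((r : ℂ) ^ 2)), torusOp r (simpleRoot k) (fOp r l a)
      = (r : ℂ) ^ (-pairing k l) • (fOp r l (torusOp r (simpleRoot k) a)) :=
    fun k l => LinearMap.congr_fun (KF k l)
  have EKa : ∀ (k l : Fin (n - 1)) (a : Aq n ((r : ℂ) ^ 2)), eOp r l (torusOp r (-simpleRoot k) a)
      = (r : ℂ) ^ (pairing k l) • (torusOp r (-simpleRoot k) (eOp r l a)) :=
    fun k l => LinearMap.congr_fun (EK k l)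
  have FKa : ∀ (k l : Fin (n - 1)) (a : Aq n ((r : ℂ) ^ 2)), fOp r l (torusOp r (-simpleRoot k) a)
      = (r : ℂ) ^ (-pairing k l) • (torusOp r (-simpleRoot k) (fOp r l a)) :=
    fun k l => LinearMap.congr_fun (FK k l)
  have vec := vector_relations_end n r
  have comm_ef : ∀ (i j : Fin (n - 1)) (a b : Aq n ((r : ℂ) ^ 2)),
      eOp r i (fOp r j (a * b)) - fOp r j (eOp r i (a * b))
      = (eOp r i (fOp r j a) - fOp r j (eOp r i a))
          * torusOp r (-simpleRoot i) (torusOp r (-simpleRoot j) b)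
        + torusOp r (simpleRoot i) (torusOp r (simpleRoot j) a)
          * (eOp r i (fOp r j b) - fOp r j (eOp r i b)) := by
    intro i j a b
    have hpp : (r : ℂ) ^ (-pairing i j) * (r : ℂ) ^ (pairing i j) = 1 := by
      rw [← zpow_add₀ hr, neg_add_cancel, zpow_zero]
    have hpp' : (r : ℂ) ^ (pairing i j) * (r : ℂ) ^ (-pairing i j) = 1 := by
      rw [mul_comm, hpp]
    simp only [fOp_mul, eOp_mul, map_add]
    rw [KFa i j, KEa j i, EKa j i, FKa i j, pairing_symm j i, smul_mul_smul_comm,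
      smul_mul_smul_comm, hpp, hpp', one_smul, one_smul,
      torusOp_comm_apply r (-simpleRoot j) (-simpleRoot i),
      torusOp_comm_apply r (simpleRoot j) (simpleRoot i), sub_mul, mul_sub]
    abel
  have comm_ee : ∀ i j : Fin (n - 1), pairing i j = 0 → ∀ a b : Aq n ((r : ℂ) ^ 2),
      eOp r i (eOp r j (a * b)) - eOp r j (eOp r i (a * b))
      = (eOp r i (eOp r j a) - eOp r j (eOp r i a))
          * torusOp r (-simpleRoot i) (torusOp r (-simpleRoot j) b)
        + torusOp r (simpleRoot i) (torusOp r (simpleRoot j) a)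
          * (eOp r i (eOp r j b) - eOp r j (eOp r i b)) := by
    intro i j hij a b
    simp only [eOp_mul, map_add]
    rw [KEa i j, KEa j i, EKa j i, EKa i j, pairing_symm j i, hij, zpow_zero, one_smul, one_smul,
      one_smul, one_smul,
      torusOp_comm_apply r (-simpleRoot j) (-simpleRoot i),
      torusOp_comm_apply r (simpleRoot j) (simpleRoot i), sub_mul, mul_sub]
    abel
  have comm_ff : ∀ i j : Fin (n - 1), pairing i j = 0 → ∀ a b : Aq n ((r : ℂ) ^ 2),
      fOp r i (fOp r j (a * b)) - fOp r j (fOp r i (a * b))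
      = (fOp r i (fOp r j a) - fOp r j (fOp r i a))
          * torusOp r (-simpleRoot i) (torusOp r (-simpleRoot j) b)
        + torusOp r (simpleRoot i) (torusOp r (simpleRoot j) a)
          * (fOp r i (fOp r j b) - fOp r j (fOp r i b)) := by
    intro i j hij a b
    simp only [fOp_mul, map_add]
    rw [KFa i j, KFa j i, FKa j i, FKa i j, pairing_symm j i, hij, neg_zero, zpow_zero, one_smul,
      one_smul, one_smul, one_smul,
      torusOp_comm_apply r (-simpleRoot j) (-simpleRoot i),
      torusOp_comm_apply r (simpleRoot j) (simpleRoot i), sub_mul, mul_sub]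
    abel
  refine ⟨?_, torusOp_add r, torusOp_eOp r, torusOp_fOp r, ?_, ?_, ?_, ?_, ?_, ?_⟩
  · refine end_ext _ _ (fun t => ?_) (fun i j => ?_) (fun a b ha hb => ?_)
    · simp only [torusOp_algebraMap, Module.End.one_apply]
    · exact eq_on_x r vec.K_zero (torus_rowMap r _) (fun i v => rfl) i j
    · rw [torusOp_mul, ha, hb]; rfl
  · intro k
    refine end_ext _ _ (fun t => ?_) (fun i j => ?_) (fun a b ha hb => ?_)
    · simp [Module.End.mul_apply, torusOp_algebraMap, fOp_algebraMap, eOp_algebraMap]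
    · exact eq_on_x r (vec.E_F k)
        (fun i v => by simp only [Module.End.mul_apply, LinearMap.smul_apply, LinearMap.sub_apply,
          eOp_rowMap, fOp_rowMap, map_smul, map_sub])
        (fun i v => by simp only [LinearMap.sub_apply, torus_rowMap, map_sub]) i j
    · simp only [Module.End.mul_apply, LinearMap.smul_apply, LinearMap.sub_apply, neg_add,
        torusOp_add, torusOp_mul] at ha hb ⊢
      rw [comm_ef, smul_add, ← smul_mul_assoc, ← mul_smul_comm, ha, hb, sub_mul, mul_sub]
      abel
  · intro k l hkl
    refine end_ext _ _ (fun t => ?_) (fun i j => ?_) (fun a b ha hb => ?_)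
    · simp [Module.End.mul_apply, fOp_algebraMap, eOp_algebraMap]
    · exact eq_on_x r (vec.E_F_ne k l hkl)
        (fun i v => by simp only [Module.End.mul_apply, eOp_rowMap, fOp_rowMap])
        (fun i v => by simp only [Module.End.mul_apply, eOp_rowMap, fOp_rowMap]) i j
    · simp only [Module.End.mul_apply] at ha hb ⊢
      rw [← sub_eq_zero, comm_ef, ha, hb, sub_self, sub_self, zero_mul, mul_zero, add_zero]
  · intro k l hkl
    refine end_ext _ _ (fun t => ?_) (fun i j => ?_) (fun a b ha hb => ?_)
    · simp [Module.End.mul_apply, eOp_algebraMap]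
    · exact eq_on_x r (vec.serre_E k l hkl)
        (fun i v => by simp only [Module.End.mul_apply, LinearMap.smul_apply, LinearMap.sub_apply,
          LinearMap.add_apply, eOp_rowMap, map_smul, map_sub, map_add])
        (fun i v => by simp) i j
    · have h1 := KE k k
      have h2 := EK k k
      have h3 := KE l k
      have h4 := EK k l
      have h5 := KE k l
      have h6 := EK l k
      rw [pairing_self] at h1 h2
      rw [pairing_adj l k hkl.symm] at h3 h6
      rw [pairing_adj k l hkl] at h4 h5
      exact serre_mul (fun k => torusOp r (simpleRoot k)) (fun k => torusOp r (-simpleRoot k))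
        (fun _ _ => torusOp_comm r _ _) (fun _ _ => torusOp_comm r _ _) _ _ _ (pow_ne_zero 2 hr) (zpow_mul_zpow_two r) (zpow_mul_zpow_neg r)
        (eOp r) (eOp_mul r) k l h1 h2 h3 h4 h5 h6 a b ha hb
  · intro k l hkl
    refine end_ext _ _ (fun t => ?_) (fun i j => ?_) (fun a b ha hb => ?_)
    · simp [Module.End.mul_apply, fOp_algebraMap]
    · exact eq_on_x r (vec.serre_F k l hkl)
        (fun i v => by simp only [Module.End.mul_apply, LinearMap.smul_apply, LinearMap.sub_apply,
          LinearMap.add_apply, fOp_rowMap, map_smul, map_sub, map_add])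
        (fun i v => by simp) i j
    · have h1 := KF k k
      have h2 := FK k k
      have h3 := KF l k
      have h4 := FK k l
      have h5 := KF k l
      have h6 := FK l k
      rw [pairing_self] at h1 h2
      rw [pairing_adj l k hkl.symm] at h3 h6
      rw [pairing_adj k l hkl] at h4 h5
      have key : ((r : ℂ) ^ 2 + ((r : ℂ) ^ 2)⁻¹) = (((r : ℂ) ^ 2)⁻¹ + (((r : ℂ) ^ 2)⁻¹)⁻¹) := by
        rw [inv_inv, add_comm]
      rw [key] at ha hb ⊢
      exact serre_mul (fun k => torusOp r (simpleRoot k)) (fun k => torusOp r (-simpleRoot k))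
        (fun _ _ => torusOp_comm r _ _) (fun _ _ => torusOp_comm r _ _) _ _ _ (inv_ne_zero (pow_ne_zero 2 hr)) (zpow_mul_zpow_neg_two r)
        ((zpow_mul_zpow_one r).trans (inv_inv _).symm)
        (fOp r) (fOp_mul r) k l h1 h2 h3 h4 h5 h6 a b ha hb
  · intro k l hkl
    refine end_ext _ _ (fun t => ?_) (fun i j => ?_) (fun a b ha hb => ?_)
    · simp [Module.End.mul_apply, eOp_algebraMap]
    · exact eq_on_x r (vec.comm_E k l hkl)
        (fun i v => by simp only [Module.End.mul_apply, eOp_rowMap])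
        (fun i v => by simp only [Module.End.mul_apply, eOp_rowMap]) i j
    · simp only [Module.End.mul_apply] at ha hb ⊢
      rw [← sub_eq_zero, comm_ee k l (pairing_far k l hkl), ha, hb, sub_self, sub_self, zero_mul,
        mul_zero, add_zero]
  · intro k l hkl
    refine end_ext _ _ (fun t => ?_) (fun i j => ?_) (fun a b ha hb => ?_)
    · simp [Module.End.mul_apply, fOp_algebraMap]
    · exact eq_on_x r (vec.comm_F k l hkl)
        (fun i v => by simp only [Module.End.mul_apply, fOp_rowMap])
        (fun i v => by simp only [Module.End.mul_apply, fOp_rowMap]) i j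
    · simp only [Module.End.mul_apply] at ha hb ⊢
      rw [← sub_eq_zero, comm_ff k l (pairing_far k l hkl), ha, hb, sub_self, sub_self, zero_mul,
        mul_zero, add_zero]

end Action

/-- The representation `ρ` of `U_q(gl_n)` on `A_q(Mat_n)`; see `rho_qpow_x`, …, `rho_f_mul` for its
characterization. -/
noncomputable def rho (n : ℕ) (r : ℂˣ) :
    Uq n r →ₐ[ℂ] Module.End ℂ (Aq n ((r : ℂ) ^ 2)) :=
  Uq.lift (aq_relations r)

section rho

variable {n : ℕ} (r : ℂˣ)

theorem rho_qpow_x (m : Fin n → ℤ) (i j : Fin n) :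
    rho n r (Uq.qpow r m) (Aq.x _ i j) = ((r : ℂ) ^ (m j)) • Aq.x _ i j := by
  simp [rho, torusOp]

theorem rho_e_x (k : Fin (n - 1)) (i j : Fin n) :
    rho n r (Uq.e r k) (Aq.x _ i j) = if j = hi k then Aq.x _ i (lo k) else 0 := by
  simp [rho, eOp, shiftOp_x]

theorem rho_f_x (k : Fin (n - 1)) (i j : Fin n) :
    rho n r (Uq.f r k) (Aq.x _ i j) = if j = lo k then Aq.x _ i (hi k) else 0 := by
  simp [rho, fOp, shiftOp_x]

theorem rho_qpow_one (m : Fin n → ℤ) : rho n r (Uq.qpow r m) 1 = 1 := by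
  simp [rho, torusOp]

theorem rho_e_one (k : Fin (n - 1)) : rho n r (Uq.e r k) 1 = 0 := by
  simpa [rho] using eOp_algebraMap r k 1

theorem rho_f_one (k : Fin (n - 1)) : rho n r (Uq.f r k) 1 = 0 := by
  simpa [rho] using fOp_algebraMap r k 1

theorem rho_qpow_mul (m : Fin n → ℤ) (a b : Aq n ((r : ℂ) ^ 2)) :
    rho n r (Uq.qpow r m) (a * b) = rho n r (Uq.qpow r m) a * rho n r (Uq.qpow r m) b := by
  simp [rho, torusOp]

theorem rho_e_mul (k : Fin (n - 1)) (a b : Aq n ((r : ℂ) ^ 2)) :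
    rho n r (Uq.e r k) (a * b)
      = rho n r (Uq.e r k) a * rho n r (Uq.qpow r (-simpleRoot k)) b
        + rho n r (Uq.qpow r (simpleRoot k)) a * rho n r (Uq.e r k) b := by
  simpa [rho] using eOp_mul r k a b

theorem rho_f_mul (k : Fin (n - 1)) (a b : Aq n ((r : ℂ) ^ 2)) :
    rho n r (Uq.f r k) (a * b)
      = rho n r (Uq.f r k) a * rho n r (Uq.qpow r (-simpleRoot k)) b
        + rho n r (Uq.qpow r (simpleRoot k)) a * rho n r (Uq.f r k) b := by
  simpa [rho] using fOp_mul r k a b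

end rho

/-- The number of inversions of a permutation. -/
def inv {n : ℕ} (w : Equiv.Perm (Fin n)) : ℕ :=
  (Finset.univ.filter fun p : Fin n × Fin n => p.1 < p.2 ∧ w p.2 < w p.1).card

/-- The number of cycles of a permutation, fixed points included: the number of parts of the
partition of `n` formed by the cycle lengths. -/
def cyc {n : ℕ} (w : Equiv.Perm (Fin n)) : ℕ := Multiset.card w.partition.parts

/-- The quantum `α`-determinant
`D(j_1, …, j_n) = ∑_w α^{n - cyc w} q^{inv w} x_{w(1) j_1} ⋯ x_{w(n) j_n}`, `q = r ^ 2`. -/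
noncomputable def alphaDetAt {n : ℕ} (r : ℂˣ) (α : ℂ) (j : Fin n → Fin n) :
    Aq n ((r : ℂ) ^ 2) :=
  ∑ w : Equiv.Perm (Fin n), (α ^ (n - cyc w) * ((r : ℂ) ^ 2) ^ inv w) •
    (List.ofFn fun i => Aq.x ((r : ℂ) ^ 2) (w i) (j i)).prod

/-- The quantum `α`-determinant
`det_q^{(α)} = ∑_w α^{n - cyc w} q^{inv w} x_{w(1) 1} ⋯ x_{w(n) n}`. -/
noncomputable def alphaDet (n : ℕ) (r : ℂˣ) (α : ℂ) : Aq n ((r : ℂ) ^ 2) :=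
  ∑ w : Equiv.Perm (Fin n), (α ^ (n - cyc w) * ((r : ℂ) ^ 2) ^ inv w) •
    (List.ofFn fun i => Aq.x ((r : ℂ) ^ 2) (w i) i).prod

/-- The cyclic module `V_{n,q}^{(α)} = ρ(U_q(gl_n)) · det_q^{(α)}`, the set of all
`ρ(u) det_q^{(α)}`. -/
noncomputable def cyclicModule (n : ℕ) (r : ℂˣ) (α : ℂ) :
    Submodule ℂ (Aq n ((r : ℂ) ^ 2)) :=
  LinearMap.range ((LinearMap.applyₗ (alphaDet n r α)).comp (rho n r).toLinearMap)

theorem mem_cyclicModule {n : ℕ} {r : ℂˣ} {α : ℂ} {a : Aq n ((r : ℂ) ^ 2)} :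
    a ∈ cyclicModule n r α ↔ ∃ u : Uq n r, rho n r u (alphaDet n r α) = a :=
  Iff.rfl

end QuantumAlpha

namespace QuantumAlpha

/-! The theorem splits into a formal half and a half about `(ℂ^n)^{⊗n}` alone.

Formal half. In `x_{w(1) j_1} ⋯ x_{w(n) j_n}` the algebra `U_q` only touches the column indices: for
a fixed row `i`, the map `v_j ↦ x_{ij}` is equivariant on generators, and both the action on
products in `A_q` and the action on tensors come from the same iterated coproduct. So for every
fixed `w` the map `v_{j_1} ⊗ ⋯ ⊗ v_{j_n} ↦ x_{w(1) j_1} ⋯ x_{w(n) j_n}` is a homomorphism of modules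
(`rowProduct_tensorRep`), and so is any linear combination of such maps over `w`. The map `Φ` is one
of these combinations (`alphaDetMap`); the particular coefficients `α^{n - cyc w} q^{inv w}` play no
role.

Since `Φ(v_1 ⊗ ⋯ ⊗ v_n) = det_q^{(α)}`, the cyclic module is the image under `Φ` of the submodule
generated by `v_1 ⊗ ⋯ ⊗ v_n`. Everything therefore follows once `v_1 ⊗ ⋯ ⊗ v_n` is known to generate
the whole tensor power (`range_tensorRep_basisTensor_id`).

Generation. Let `W` be the submodule generated. First, `W` contains the weight space `(1, …, 1)`,
spanned by the tensors `v_{w(1)} ⊗ ⋯ ⊗ v_{w(n)}`: applying `e_k` and then `f_k` to such a tensor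
gives a combination, with nonzero coefficients, of it and the tensor with labels `k`, `k + 1`
exchanged (`basisTensor_swap_mul_mem`). Second, `U_q(sl_2)`-theory shows that if `m_k > m_{k+1}`,
then the weight space `m` lies in `W` as soon as the one of weight `m - (ε_k - ε_{k+1})` does, and
symmetrically with `f_k` (`wtSpace_le_of_lower_le`, which is where `q` must not be a root of unity).
Third, every weight with entries summing to `n` is linked to `(1, …, 1)` by such moves
(`wtSpan_le_of_wtSpan_one_le`): the partial sums of `m - (1, …, 1)` vanish at both ends, and at a
positive maximum or a negative minimum a permitted move brings one partial sum closer to `0` without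
changing the others. -/

/-- A principle of induction on `U_q(gl_n)`. -/
theorem Uq.induction {n : ℕ} {r : ℂˣ} {P : Uq n r → Prop}
    (hC : ∀ c : ℂ, P (algebraMap ℂ _ c)) (he : ∀ k, P (Uq.e r k)) (hf : ∀ k, P (Uq.f r k))
    (hK : ∀ m, P (Uq.qpow r m)) (hmul : ∀ a b, P a → P b → P (a * b))
    (hadd : ∀ a b, P a → P b → P (a + b)) (a : Uq n r) : P a := by
  obtain ⟨a, rfl⟩ := RingQuot.mkAlgHom_surjective ℂ (UqRel n r) a
  induction a using FreeAlgebra.induction with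
  | grade0 c => simpa using hC c
  | grade1 p =>
    cases p with
    | e k => exact he k
    | f k => exact hf k
    | qpow m => exact hK m
  | mul a b ha hb => rw [map_mul]; exact hmul _ _ ha hb
  | add a b ha hb => rw [map_add]; exact hadd _ _ ha hb

/-! ### Products of entries in fixed rows as homomorphisms from the tensor power to `A_q`. -/

section Intertwining

variable {n : ℕ} (r : ℂˣ)

theorem torusOp_prod_ofFn (m : Fin n → ℤ) {N : ℕ} (a : Fin N → Aq n ((r : ℂ) ^ 2)) :
    torusOp r m (List.ofFn a).prod = (List.ofFn fun i => torusOp r m (a i)).prod := by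
  simp [torusOp, map_list_prod, List.map_ofFn, Function.comp_def]

/-- The iterated coproduct formula for a skew derivation. -/
theorem skew_derivation_prod_ofFn {A : Type*} [Ring A] [Algebra ℂ A] (X κ κ' : Module.End ℂ A)
    (hX : ∀ a b, X (a * b) = X a * κ' b + κ a * X b) (hX1 : X 1 = 0)
    (hκ' : ∀ (N : ℕ) (a : Fin N → A), κ' (List.ofFn a).prod = (List.ofFn fun i => κ' (a i)).prod)
    {N : ℕ} (a : Fin N → A) :
    X (List.ofFn a).prod = ∑ l : Fin N,
      (List.ofFn fun i => (if i < l then κ else if i = l then X else κ') (a i)).prod := by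
  induction N with
  | zero => simp [hX1]
  | succ N ih =>
    -- Splitting off the first factor: `X` on it with `κ'` on the whole tail is the summand `l = 0`,
    -- and `κ` on it with `X` on the tail gives the summands `l ≥ 1` by induction. Multiplicativity
    -- is needed only for `κ'`, because `κ` always meets a single factor.
    rw [List.ofFn_succ, List.prod_cons, hX, ih, hκ', Fin.sum_univ_succ, Finset.mul_sum]
    simp [List.ofFn_succ, Fin.succ_ne_zero, Fin.succ_inj]

/-- The linear map `(ℂ^n)^{⊗n} → A_q`, `v_{j_1} ⊗ ⋯ ⊗ v_{j_N} ↦ x_{w(1) j_1} ⋯ x_{w(N) j_N}`. -/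
noncomputable def rowProduct {N : ℕ} (w : Fin N → Fin n) :
    (⨂[ℂ] _ : Fin N, (Fin n → ℂ)) →ₗ[ℂ] Aq n ((r : ℂ) ^ 2) :=
  PiTensorProduct.lift
    ((MultilinearMap.mkPiAlgebraFin ℂ N (Aq n ((r : ℂ) ^ 2))).compLinearMap
      fun i => rowMap r (w i))

theorem rowProduct_tprod {N : ℕ} (w : Fin N → Fin n) (v : Fin N → Fin n → ℂ) :
    rowProduct r w (PiTensorProduct.tprod ℂ v)
      = (List.ofFn fun i => rowMap r (w i) (v i)).prod := by
  simp [rowProduct]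

/-- This matches the `l`-th summand of the coproduct on tensors with the `l`-th summand of
`skew_derivation_prod_ofFn`; only the equivariance of each row map under the three operators is
needed. -/
theorem rowProduct_siteOp {N : ℕ} (w : Fin N → Fin n) {X κ κ' : Module.End ℂ (Aq n ((r : ℂ) ^ 2))}
    {x k k' : Module.End ℂ (Fin n → ℂ)}
    (hX : ∀ i v, X (rowMap r i v) = rowMap r i (x v))
    (hκ : ∀ i v, κ (rowMap r i v) = rowMap r i (k v))
    (hκ' : ∀ i v, κ' (rowMap r i v) = rowMap r i (k' v)) (l : Fin N) (v : Fin N → Fin n → ℂ) :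
    rowProduct r w (siteOp k x k' l (PiTensorProduct.tprod ℂ v))
      = (List.ofFn fun i =>
          (if i < l then κ else if i = l then X else κ') (rowMap r (w i) (v i))).prod := by
  rw [siteOp, tmap, PiTensorProduct.map_tprod, rowProduct_tprod]
  congr 2
  funext i
  split_ifs <;> simp [hX, hκ, hκ']

theorem vectorRep_qpow (m : Fin n → ℤ) : vectorRep n r (Uq.qpow r m)
    = Matrix.toLin' (Matrix.diagonal fun j => (r : ℂ) ^ (m j)) := Uq.lift_qpow _ _

theorem vectorRep_e (k : Fin (n - 1)) : vectorRep n r (Uq.e r k)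
    = Matrix.toLin' (Matrix.single (lo k) (hi k) (1 : ℂ)) := Uq.lift_e _ _

theorem vectorRep_f (k : Fin (n - 1)) : vectorRep n r (Uq.f r k)
    = Matrix.toLin' (Matrix.single (hi k) (lo k) (1 : ℂ)) := Uq.lift_f _ _

theorem tensorRep_qpow (N : ℕ) (m : Fin n → ℤ) :
    tensorRep N (vectorRep n r) (Uq.qpow r m)
      = tmap fun _ => vectorRep n r (Uq.qpow r m) := Uq.lift_qpow _ _

theorem tensorRep_e (N : ℕ) (k : Fin (n - 1)) :
    tensorRep N (vectorRep n r) (Uq.e r k)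
      = ∑ l, siteOp (vectorRep n r (Uq.qpow r (simpleRoot k))) (vectorRep n r (Uq.e r k))
          (vectorRep n r (Uq.qpow r (-simpleRoot k))) l := Uq.lift_e _ _

theorem tensorRep_f (N : ℕ) (k : Fin (n - 1)) :
    tensorRep N (vectorRep n r) (Uq.f r k)
      = ∑ l, siteOp (vectorRep n r (Uq.qpow r (simpleRoot k))) (vectorRep n r (Uq.f r k))
          (vectorRep n r (Uq.qpow r (-simpleRoot k))) l := Uq.lift_f _ _

theorem rho_qpow (m : Fin n → ℤ) : rho n r (Uq.qpow r m) = torusOp r m := Uq.lift_qpow _ _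

theorem rho_e (k : Fin (n - 1)) : rho n r (Uq.e r k) = eOp r k := Uq.lift_e _ _

theorem rho_f (k : Fin (n - 1)) : rho n r (Uq.f r k) = fOp r k := Uq.lift_f _ _

/-- `rowProduct` is a homomorphism of `U_q(gl_n)`-modules. -/
theorem rowProduct_tensorRep {N : ℕ} (w : Fin N → Fin n) (u : Uq n r)
    (t : ⨂[ℂ] _ : Fin N, (Fin n → ℂ)) :
    rowProduct r w (tensorRep N (vectorRep n r) u t) = rho n r u (rowProduct r w t) := by
  have hK (m : Fin n → ℤ) (i : Fin n) (v : Fin n → ℂ) :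
      torusOp r m (rowMap r i v) = rowMap r i (vectorRep n r (Uq.qpow r m) v) := by
    rw [vectorRep_qpow, torus_rowMap]
  -- The identity is stated for all tensors at once because the product case of the induction on `u`
  -- applies the hypothesis for one factor to the image under the other.
  suffices h : rowProduct r w ∘ₗ tensorRep N (vectorRep n r) u = rho n r u ∘ₗ rowProduct r w from
    LinearMap.congr_fun h t
  induction u using Uq.induction with
  | hC c => ext v; simp [Algebra.algebraMap_eq_smul_one]
  | he k =>
    refine PiTensorProduct.ext (MultilinearMap.ext fun v => ?_)
    simp only [LinearMap.compMultilinearMap_apply, LinearMap.comp_apply, tensorRep_e, rho_e,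
      LinearMap.sum_apply, map_sum, rowProduct_tprod]
    rw [skew_derivation_prod_ofFn _ _ _ (eOp_mul r k)
      (by simpa using eOp_algebraMap r k 1) (fun _ => torusOp_prod_ofFn r _)]
    exact Finset.sum_congr rfl fun l _ => rowProduct_siteOp r w
      (fun i v => by rw [vectorRep_e, eOp_rowMap]) (hK _) (hK _) l v
  | hf k =>
    refine PiTensorProduct.ext (MultilinearMap.ext fun v => ?_)
    simp only [LinearMap.compMultilinearMap_apply, LinearMap.comp_apply, tensorRep_f, rho_f,
      LinearMap.sum_apply, map_sum, rowProduct_tprod]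
    rw [skew_derivation_prod_ofFn _ _ _ (fOp_mul r k)
      (by simpa using fOp_algebraMap r k 1) (fun _ => torusOp_prod_ofFn r _)]
    exact Finset.sum_congr rfl fun l _ => rowProduct_siteOp r w
      (fun i v => by rw [vectorRep_f, fOp_rowMap]) (hK _) (hK _) l v
  | hK m =>
    refine PiTensorProduct.ext (MultilinearMap.ext fun v => ?_)
    simp only [LinearMap.compMultilinearMap_apply, LinearMap.comp_apply, tensorRep_qpow, rho_qpow,
      rowProduct_tprod, tmap, PiTensorProduct.map_tprod, torusOp_prod_ofFn, hK]
  | hmul a b ha hb =>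
    rw [map_mul, map_mul, Module.End.mul_eq_comp, Module.End.mul_eq_comp, ← LinearMap.comp_assoc,
      ha, LinearMap.comp_assoc, hb, LinearMap.comp_assoc]
  | hadd a b ha hb =>
    rw [map_add, map_add, LinearMap.comp_add, LinearMap.add_comp, ha, hb]

/-- The linear map `(ℂ^n)^{⊗n} → A_q`, `v_{j_1} ⊗ ⋯ ⊗ v_{j_n} ↦ D(j_1, …, j_n)`. -/
noncomputable def alphaDetMap (α : ℂ) :
    (⨂[ℂ] _ : Fin n, (Fin n → ℂ)) →ₗ[ℂ] Aq n ((r : ℂ) ^ 2) :=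
  ∑ w : Equiv.Perm (Fin n), (α ^ (n - cyc w) * ((r : ℂ) ^ 2) ^ inv w) • rowProduct r w

theorem alphaDetMap_tprod (α : ℂ) (j : Fin n → Fin n) :
    alphaDetMap r α (PiTensorProduct.tprod ℂ fun i => Pi.single (j i) (1 : ℂ))
      = alphaDetAt r α j := by
  simp [alphaDetMap, alphaDetAt, rowProduct_tprod, rowMap_single]

/-- A linear combination of homomorphisms is a homomorphism, whatever its coefficients. -/
theorem alphaDetMap_tensorRep (α : ℂ) (u : Uq n r) (t : ⨂[ℂ] _ : Fin n, (Fin n → ℂ)) :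
    alphaDetMap r α (tensorRep n (vectorRep n r) u t) = rho n r u (alphaDetMap r α t) := by
  simp [alphaDetMap, rowProduct_tensorRep]

end Intertwining

/-! ### Quantum `sl_2`: surjectivity of raising operators onto positive weights. -/

/-- Vanishing would give `q^{2d} = 1`. This is the one place where the proof uses that `q` is not a
root of unity: the quantum integers are nonzero. -/
theorem zpow_sub_zpow_neg_ne_zero {q : ℂ} (hq0 : q ≠ 0) (hq : ∀ k : ℕ, 0 < k → q ^ k ≠ 1) {d : ℤ}
    (hd : 0 < d) : q ^ d - q ^ (-d) ≠ 0 := by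
  intro h
  lift d to ℕ using hd.le
  have h1 : q ^ (d : ℤ) * q ^ (-(d : ℤ)) = 1 := by
    rw [← zpow_add₀ hq0, add_neg_cancel, zpow_zero]
  rw [← sub_eq_zero.mp h, zpow_natCast, ← pow_add] at h1
  exact hq _ (by omega) h1

section Sl2

variable {V : Type*} [AddCommGroup V] [Module ℂ V] {q : ℂ} {E F : Module.End ℂ V} {h : ℤ}
  {wtSpace : ℤ → Submodule ℂ V}

theorem pow_apply_mem_wtSpace (hE : ∀ t, ∀ u ∈ wtSpace t, E u ∈ wtSpace (t + 1)) {u : V}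
    (hu : u ∈ wtSpace 0) (s : ℕ) : (E ^ s) u ∈ wtSpace s := by
  induction s with
  | zero => simpa using hu
  | succ s ih =>
    rw [pow_succ', Module.End.mul_apply]
    exact_mod_cast hE _ _ ih

/-- This is the classical `[E^{s+1}, F] u = [s+1] [h+s] E^s u` on weight `h`, with the denominators
of the quantum integers cleared. Writing `[E^{s+2}, F] = E [E^{s+1}, F] + [E, F] E^{s+1}` and noting
that `E^{s+1} u` has weight `h + 2(s+1)`, the induction reduces to `[s+1] [h+s] + [h+2s+2] = [s+2]
[h+s+1]`. -/
theorem pow_succ_apply_comm (hq0 : q ≠ 0) (hE : ∀ t, ∀ u ∈ wtSpace t, E u ∈ wtSpace (t + 1))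
    (hEF : ∀ t, ∀ u ∈ wtSpace t, (q - q⁻¹) • (E (F u) - F (E u))
      = (q ^ (h + 2 * t) - q ^ (-(h + 2 * t))) • u) {u : V} (hu : u ∈ wtSpace 0) (s : ℕ) :
    ((q - q⁻¹) ^ 2) • ((E ^ (s + 1)) (F u) - F ((E ^ (s + 1)) u))
      = ((q ^ (s + 1 : ℤ) - q ^ (-(s + 1 : ℤ))) * (q ^ (h + s) - q ^ (-(h + s)))) • (E ^ s) u := by
  induction s with
  | zero =>
    have := hEF 0 u hu
    simp only [mul_zero, add_zero] at this
    simp [sq, mul_smul, this]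
  | succ s ih =>
    have h2 := hEF _ _ (pow_apply_mem_wtSpace hE hu (s + 1))
    have hp (s : ℕ) (x : V) : (E ^ (s + 1)) x = E ((E ^ s) x) := by
      rw [pow_succ', Module.End.mul_apply]
    have h1 := congrArg E ih
    simp only [map_smul, map_sub] at h1
    rw [← hp s u] at h1
    have e : ((q - q⁻¹) ^ 2) • ((E ^ (s + 1 + 1)) (F u) - F ((E ^ (s + 1 + 1)) u))
        = ((q - q⁻¹) ^ 2) • (E ((E ^ (s + 1)) (F u)) - E (F ((E ^ (s + 1)) u)))
          + (q - q⁻¹) • (q - q⁻¹) • (E (F ((E ^ (s + 1)) u)) - F (E ((E ^ (s + 1)) u))) := by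
      rw [hp (s + 1), hp (s + 1)]
      module
    rw [e, h2, h1, smul_smul, ← add_smul]
    congr 1
    push_cast
    have a1 : q ^ (s : ℤ) ≠ 0 := zpow_ne_zero _ hq0
    have a2 : q ^ h ≠ 0 := zpow_ne_zero _ hq0
    simp only [neg_add, mul_add, zpow_add₀ hq0, two_mul, zpow_neg, zpow_one]
    field_simp
    ring

/-- If `h > 0`, the raising operator maps the space of weight `h - 2` onto the one of weight `h`,
in the form in which it applies to a submodule stable under that operator. -/
theorem wtSpace_le_of_lower_le (hq0 : q ≠ 0) (hq : ∀ k : ℕ, 0 < k → q ^ k ≠ 1)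
    (hE : ∀ t, ∀ u ∈ wtSpace t, E u ∈ wtSpace (t + 1))
    (hF : ∀ t, ∀ u ∈ wtSpace t, F u ∈ wtSpace (t - 1))
    (hEF : ∀ t, ∀ u ∈ wtSpace t, (q - q⁻¹) • (E (F u) - F (E u))
      = (q ^ (h + 2 * t) - q ^ (-(h + 2 * t))) • u)
    (hh : 0 < h) (N : ℕ) (hN : wtSpace N = ⊥) {W : Submodule ℂ V} (hWE : ∀ u ∈ W, E u ∈ W)
    (hW : wtSpace (-1) ≤ W) : wtSpace 0 ≤ W := by
  -- Induction on the order of nilpotency of `E` at `u`: modulo `E (F u)`, which lies in `W` because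
  -- `F u` has the lower weight, a nonzero multiple of `u` is replaced by a vector killed by one
  -- power of `E` less.
  have key : ∀ (s : ℕ) (u : V), u ∈ wtSpace 0 → (E ^ s) u = 0 → u ∈ W := by
    intro s
    induction s with
    | zero =>
      intro u _ h0
      have h0 : u = 0 := by simpa using h0
      exact h0 ▸ W.zero_mem
    | succ s ih =>
      intro u hu h0
      have hFu : F u ∈ wtSpace (-1) := by simpa using hF 0 u hu
      have hEFu : E (F u) ∈ wtSpace 0 := by simpa using hE _ _ hFu
      have hc := pow_succ_apply_comm hq0 hE hEF hu s
      rw [h0, map_zero, sub_zero] at hc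
      set c : ℂ := (q ^ (s + 1 : ℤ) - q ^ (-(s + 1 : ℤ))) * (q ^ (h + s) - q ^ (-(h + s))) with hcdef
      -- Positivity of `h` enters here: it keeps `h + s` away from `0` for every `s ≥ 0`.
      have hc0 : c ≠ 0 := mul_ne_zero (zpow_sub_zpow_neg_ne_zero hq0 hq (by omega))
        (zpow_sub_zpow_neg_ne_zero hq0 hq (by omega))
      have h1 : c • u - ((q - q⁻¹) ^ 2) • E (F u) ∈ W := by
        refine ih _ (sub_mem (Submodule.smul_mem _ _ hu) (Submodule.smul_mem _ _ hEFu)) ?_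
        -- Since `E^{s+1} u = 0`, the commutator formula reads `(q - q⁻¹)^2 E^{s+1} F u = c E^s u`,
        -- so `E^s` kills the corrected vector.
        rw [map_sub, map_smul, map_smul, ← hc, pow_succ E, Module.End.mul_apply, sub_self]
      have h2 : c • u ∈ W := by
        rw [← sub_add_cancel (c • u) (((q - q⁻¹) ^ 2) • E (F u))]
        exact add_mem h1 (Submodule.smul_mem _ ((q - q⁻¹) ^ 2) (hWE _ (hW hFu)))
      exact (Submodule.smul_mem_iff _ hc0).mp h2
  intro u hu
  exact key N u hu (by simpa [hN] using pow_apply_mem_wtSpace hE hu N)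

end Sl2

/-! ### A discrete maximum principle. -/

/-- A positive maximum is attained in the interior, and at its last occurrence the sequence is
strictly concave. For `S` the partial sums of a weight minus `(1, …, 1)`, strict concavity at `k +
1` says that the entry `k` exceeds the next one. -/
theorem exists_strict_concave_of_pos {n : ℕ} {S : ℕ → ℤ} (h0 : S 0 = 0) (hn : S n = 0)
    (hS : ∃ p ≤ n, 0 < S p) :
    ∃ k, k + 1 < n ∧ 0 < S (k + 1) ∧ S k + S (k + 2) < 2 * S (k + 1) := by
  obtain ⟨p, hp, hpS⟩ := hS
  obtain ⟨m, hm, hmax⟩ := Finset.exists_max_image (Finset.range (n + 1))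
    -- The lexicographic order selects the last point where `S` is maximal, which makes the
    -- inequality with the right neighbour strict.
    (fun p => toLex (S p, p)) ⟨0, by simp⟩
  simp only [Finset.mem_range, Prod.Lex.toLex_le_toLex] at hm hmax
  have h1 := hmax p (by omega)
  have hm0 : m ≠ 0 := by rintro rfl; omega
  have hmn : m ≠ n := by rintro rfl; omega
  obtain ⟨k, rfl⟩ := Nat.exists_eq_succ_of_ne_zero hm0
  have h2 := hmax k (by omega)
  have h3 := hmax (k + 2) (by omega)
  simp only [Nat.succ_eq_add_one] at *
  exact ⟨k, by omega, by omega, by omega⟩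

/-! ### Weight spaces of the tensor power and moves between them. -/

section Weights

variable {n N : ℕ} (r : ℂˣ)

/-- The tensor `v_{j_1} ⊗ ⋯ ⊗ v_{j_N}`. -/
noncomputable def basisTensor (j : Fin N → Fin n) : ⨂[ℂ] _ : Fin N, (Fin n → ℂ) :=
  PiTensorProduct.tprod ℂ fun i => Pi.single (j i) (1 : ℂ)

/-- A linear map on the tensor power is determined by the basis tensors, so the quotient map by `W`
vanishes. -/
theorem eq_top_of_basisTensor_mem {W : Submodule ℂ (⨂[ℂ] _ : Fin N, (Fin n → ℂ))}
    (h : ∀ j, basisTensor j ∈ W) : W = ⊤ := by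
  rw [← W.ker_mkQ, LinearMap.ker_eq_top]
  ext j
  simpa [Submodule.Quotient.mk_eq_zero, basisTensor] using h j

theorem vectorRep_qpow_single (m : Fin n → ℤ) (c : Fin n) :
    vectorRep n r (Uq.qpow r m) (Pi.single c 1) = ((r : ℂ) ^ m c) • Pi.single c 1 := by
  rw [vectorRep_qpow]
  ext i
  by_cases h : i = c
  · subst h; simp
  · simp [h]

theorem toLin'_single_single (c d b : Fin n) :
    Matrix.toLin' (Matrix.single d c (1 : ℂ)) (Pi.single b 1)
      = if b = c then Pi.single d 1 else 0 := by
  split_ifs with h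
  · subst h; ext i; simp [Matrix.single_apply, Pi.single_apply, eq_comm]
  · ext i; simp [Ne.symm h]

/-- The coefficient with which `e_k` or `f_k`, placed in position `l`, acts on a basis tensor. -/
noncomputable def siteCoeff (k : Fin (n - 1)) (j : Fin N → Fin n) (l : Fin N) : ℂ :=
  ∏ i, if i < l then (r : ℂ) ^ simpleRoot k (j i) else
    if i = l then 1 else (r : ℂ) ^ (-simpleRoot k) (j i)

theorem siteCoeff_ne_zero (k : Fin (n - 1)) (j : Fin N → Fin n) (l : Fin N) :
    siteCoeff r k j l ≠ 0 := by
  refine Finset.prod_ne_zero_iff.mpr fun i _ => ?_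
  split_ifs
  · exact zpow_ne_zero _ r.ne_zero
  · exact one_ne_zero
  · exact zpow_ne_zero _ r.ne_zero

/-- Every factor other than the `l`-th is an eigenvector of the Cartan element placed there, so it
only contributes a scalar; the `l`-th factor is either relabelled or killed. Both `e_k` and `f_k`
are instances. -/
theorem siteOp_basisTensor (k : Fin (n - 1)) (c d : Fin n) (j : Fin N → Fin n) (l : Fin N) :
    siteOp (vectorRep n r (Uq.qpow r (simpleRoot k))) (Matrix.toLin' (Matrix.single d c (1 : ℂ)))
        (vectorRep n r (Uq.qpow r (-simpleRoot k))) l (basisTensor j)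
      = if j l = c then siteCoeff r k j l • basisTensor (Function.update j l d) else 0 := by
  rw [siteOp, tmap, basisTensor, PiTensorProduct.map_tprod]
  split_ifs with h
  · rw [siteCoeff, basisTensor, ← MultilinearMap.map_smul_univ]
    congr 1
    funext i
    rcases lt_trichotomy i l with hi | rfl | hi
    · simp only [hi, if_true, hi.ne, Function.update_of_ne, ne_eq, not_false_eq_true]
      rw [vectorRep_qpow_single]
    · simp only [lt_irrefl, if_true, if_false, Function.update_self, one_smul]
      rw [toLin'_single_single, if_pos h]
    · simp only [hi.not_gt, hi.ne', if_false, Function.update_of_ne, ne_eq, not_false_eq_true]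
      rw [vectorRep_qpow_single]
  · refine (PiTensorProduct.tprod ℂ).map_coord_zero l ?_
    simp only [lt_irrefl, if_true, if_false]
    rw [toLin'_single_single, if_neg h]

theorem tensorRep_e_basisTensor (k : Fin (n - 1)) (j : Fin N → Fin n) :
    tensorRep N (vectorRep n r) (Uq.e r k) (basisTensor j)
      = ∑ l, if j l = hi k then siteCoeff r k j l • basisTensor (Function.update j l (lo k))
          else 0 := by
  rw [tensorRep_e, LinearMap.sum_apply, vectorRep_e]
  exact Finset.sum_congr rfl fun l _ => siteOp_basisTensor r k _ _ j l

theorem tensorRep_f_basisTensor (k : Fin (n - 1)) (j : Fin N → Fin n) :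
    tensorRep N (vectorRep n r) (Uq.f r k) (basisTensor j)
      = ∑ l, if j l = lo k then siteCoeff r k j l • basisTensor (Function.update j l (hi k))
          else 0 := by
  rw [tensorRep_f, LinearMap.sum_apply, vectorRep_f]
  exact Finset.sum_congr rfl fun l _ => siteOp_basisTensor r k _ _ j l

theorem tensorRep_qpow_basisTensor (m : Fin n → ℤ) (j : Fin N → Fin n) :
    tensorRep N (vectorRep n r) (Uq.qpow r m) (basisTensor j)
      = ((r : ℂ) ^ ∑ i, m (j i)) • basisTensor j := by
  have h : (r : ℂ) ^ ∑ i, m (j i) = ∏ i, (r : ℂ) ^ m (j i) := by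
    induction (Finset.univ : Finset (Fin N)) using Finset.induction_on with
    | empty => simp
    | insert a s ha ih => rw [Finset.sum_insert ha, Finset.prod_insert ha, zpow_add₀ r.ne_zero, ih]
  rw [h, tensorRep_qpow, tmap, basisTensor, PiTensorProduct.map_tprod,
    ← MultilinearMap.map_smul_univ]
  simp only [vectorRep_qpow_single]

/-- The weight of `v_{j_1} ⊗ ⋯ ⊗ v_{j_N}`. -/
def wt (j : Fin N → Fin n) (c : Fin n) : ℤ := ∑ i, if j i = c then 1 else 0

theorem wt_update (j : Fin N → Fin n) (l : Fin N) (d : Fin n) :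
    wt (Function.update j l d) = wt j + (Pi.single d 1 - Pi.single (j l) 1) := by
  funext c
  rw [Pi.add_apply, ← sub_eq_iff_eq_add']
  simp only [wt, Pi.sub_apply, ← Finset.sum_sub_distrib]
  rw [Finset.sum_eq_single l]
  · simp [Pi.single_apply, eq_comm]
  · intro i _ hi
    simp [hi]
  · simp

theorem sum_apply_eq_sum_wt (m : Fin n → ℤ) (j : Fin N → Fin n) :
    ∑ i, m (j i) = ∑ c, m c * wt j c := by
  simp only [wt, Finset.mul_sum]
  rw [Finset.sum_comm]
  simp

theorem sum_wt (j : Fin N → Fin n) : ∑ c, wt j c = N := by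
  simpa using (sum_apply_eq_sum_wt (fun _ => 1) j).symm

/-- The space of tensors of weight `m`. -/
noncomputable def wtSpan (N : ℕ) (m : Fin n → ℤ) :
    Submodule ℂ (⨂[ℂ] _ : Fin N, (Fin n → ℂ)) :=
  Submodule.span ℂ (basisTensor '' {j | wt j = m})

theorem wtSpan_le_iff {m : Fin n → ℤ} {W : Submodule ℂ (⨂[ℂ] _ : Fin N, (Fin n → ℂ))} :
    wtSpan N m ≤ W ↔ ∀ j, wt j = m → basisTensor j ∈ W := by
  simp [wtSpan, Submodule.span_le, Set.subset_def]

theorem basisTensor_mem_wtSpan {j : Fin N → Fin n} {m : Fin n → ℤ} (h : wt j = m) :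
    basisTensor j ∈ wtSpan N m := wtSpan_le_iff.mp le_rfl j h

/-- The entries of a weight count occurrences of labels. This makes the `e_k` and `f_k` nilpotent
along each string of weights. -/
theorem wtSpan_eq_bot {m : Fin n → ℤ} {c : Fin n} (h : m c < 0) : wtSpan N m = ⊥ := by
  refine le_bot_iff.mp (wtSpan_le_iff.mpr ?_)
  rintro j rfl
  refine absurd h (not_lt.mpr (Finset.sum_nonneg fun i _ => ?_))
  split_ifs <;> simp

/-- The target weight is a separate variable with an equation, so that different expressions for the
same weight can be used without rewriting inside `wtSpan`. -/
theorem tensorRep_e_mem_wtSpan (k : Fin (n - 1)) {m m' : Fin n → ℤ} (h : m + simpleRoot k = m')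
    {u : ⨂[ℂ] _ : Fin N, (Fin n → ℂ)} (hu : u ∈ wtSpan N m) :
    tensorRep N (vectorRep n r) (Uq.e r k) u ∈ wtSpan N m' := by
  suffices hle : wtSpan N m ≤ (wtSpan N m').comap (tensorRep N (vectorRep n r) (Uq.e r k)) from
    hle hu
  refine wtSpan_le_iff.mpr fun j hj => ?_
  rw [Submodule.mem_comap, tensorRep_e_basisTensor]
  refine sum_mem fun l _ => ?_
  split_ifs with hl
  · exact Submodule.smul_mem _ _ (basisTensor_mem_wtSpan (by rw [wt_update, hj, hl, ← h]; rfl))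
  · exact zero_mem _

theorem tensorRep_f_mem_wtSpan (k : Fin (n - 1)) {m m' : Fin n → ℤ} (h : m - simpleRoot k = m')
    {u : ⨂[ℂ] _ : Fin N, (Fin n → ℂ)} (hu : u ∈ wtSpan N m) :
    tensorRep N (vectorRep n r) (Uq.f r k) u ∈ wtSpan N m' := by
  suffices hle : wtSpan N m ≤ (wtSpan N m').comap (tensorRep N (vectorRep n r) (Uq.f r k)) from
    hle hu
  refine wtSpan_le_iff.mpr fun j hj => ?_
  rw [Submodule.mem_comap, tensorRep_f_basisTensor]
  refine sum_mem fun l _ => ?_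
  split_ifs with hl
  · exact Submodule.smul_mem _ _ (basisTensor_mem_wtSpan
      (by rw [wt_update, hj, hl, ← h, simpleRoot]; abel))
  · exact zero_mem _

theorem tensorRep_qpow_of_mem_wtSpan (l : Fin n → ℤ) {m : Fin n → ℤ}
    {u : ⨂[ℂ] _ : Fin N, (Fin n → ℂ)} (hu : u ∈ wtSpan N m) :
    tensorRep N (vectorRep n r) (Uq.qpow r l) u = ((r : ℂ) ^ ∑ c, l c * m c) • u := by
  suffices hle : wtSpan N m ≤ LinearMap.eqLocus (tensorRep N (vectorRep n r) (Uq.qpow r l))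
      (((r : ℂ) ^ ∑ c, l c * m c) • LinearMap.id) from hle hu
  refine wtSpan_le_iff.mpr fun j hj => ?_
  rw [LinearMap.mem_eqLocus, tensorRep_qpow_basisTensor, sum_apply_eq_sum_wt, hj]
  rfl

theorem commutator_of_mem_wtSpan (k : Fin (n - 1)) {m : Fin n → ℤ}
    {u : ⨂[ℂ] _ : Fin N, (Fin n → ℂ)} (hu : u ∈ wtSpan N m) :
    let E := tensorRep N (vectorRep n r) (Uq.e r k)
    let F := tensorRep N (vectorRep n r) (Uq.f r k)
    ((r : ℂ) ^ 2 - ((r : ℂ) ^ 2)⁻¹) • (E (F u) - F (E u))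
      = (((r : ℂ) ^ 2) ^ (m (lo k) - m (hi k)) - ((r : ℂ) ^ 2) ^ (-(m (lo k) - m (hi k)))) • u := by
  intro E F
  have h := LinearMap.congr_fun
    ((tensor_relations N ((Uq.relations n r).map (vectorRep n r))).E_F k) u
  rw [← tensorRep_e, ← tensorRep_f, ← tensorRep_qpow, ← tensorRep_qpow] at h
  simp only [LinearMap.smul_apply, LinearMap.sub_apply, Module.End.mul_apply,
    tensorRep_qpow_of_mem_wtSpan r _ hu] at h
  -- The index of `qpow` is twice the exponent `λ`, hence the doubled root; the factor `2` is then
  -- absorbed by `q = r ^ 2`.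
  have hs : ∑ c, (simpleRoot k + simpleRoot k) c * m c = 2 * (m (lo k) - m (hi k)) := by
    simp only [simpleRoot, Pi.add_apply, Pi.sub_apply, add_mul, sub_mul, Finset.sum_add_distrib,
      Finset.sum_sub_distrib, Pi.single_apply, ite_mul, one_mul, zero_mul, Finset.sum_ite_eq',
      Finset.mem_univ, if_true]
    ring
  have hs' : ∑ c, (-(simpleRoot k + simpleRoot k)) c * m c = 2 * (-(m (lo k) - m (hi k))) := by
    rw [mul_neg, ← hs, ← Finset.sum_neg_distrib]
    simp only [Pi.neg_apply, neg_mul]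
  rw [hs, hs', zpow_mul, zpow_mul] at h
  exact h.trans (sub_smul _ _ _).symm

section Moves

variable {r} (hq : ∀ k : ℕ, 0 < k → ((r : ℂ) ^ 2) ^ k ≠ 1)
  {W : Submodule ℂ (⨂[ℂ] _ : Fin N, (Fin n → ℂ))}
include hq

/-- The `sl_2`-lemma for `e_k`, `f_k` on the string of weights `m + t (ε_k - ε_{k+1})`, where the
`sl_2`-weight at `t = 0` is `m_k - m_{k+1} > 0`. -/
theorem wtSpan_le_of_raise {k : Fin (n - 1)}
    (hWE : ∀ u ∈ W, tensorRep N (vectorRep n r) (Uq.e r k) u ∈ W) {m : Fin n → ℤ}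
    (hm : m (hi k) < m (lo k)) (hW : wtSpan N (m - simpleRoot k) ≤ W) : wtSpan N m ≤ W := by
  have h1 := simpleRoot_lo k
  have h2 := simpleRoot_hi k
  have := wtSpace_le_of_lower_le (q := (r : ℂ) ^ 2) (h := m (lo k) - m (hi k))
    (wtSpace := fun t => wtSpan N (m + t • simpleRoot k))
    (F := tensorRep N (vectorRep n r) (Uq.f r k))
    (pow_ne_zero 2 r.ne_zero) hq
    (fun t u hu => tensorRep_e_mem_wtSpan r k (by module) hu)
    (fun t u hu => tensorRep_f_mem_wtSpan r k (by module) hu)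
    (fun t u hu => by
      rw [commutator_of_mem_wtSpan r k hu]
      congr 4 <;> simp only [Pi.add_apply, Pi.smul_apply, h1, h2, smul_eq_mul] <;> ring)
    -- After this many steps the entry `k + 1` of the weight is negative, so the weight space is
    -- zero.
    (by omega) ((m (hi k)).toNat + 1)
    (wtSpan_eq_bot (c := hi k) (by simp [h2]; omega)) hWE (by simpa [← sub_eq_add_neg] using hW)
  simpa using this

/-- The `sl_2`-lemma with `e_k` and `f_k` exchanged: the string runs in the opposite direction, and
the commutator and the `sl_2`-weight both change sign. -/
theorem wtSpan_le_of_lower {k : Fin (n - 1)}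
    (hWF : ∀ u ∈ W, tensorRep N (vectorRep n r) (Uq.f r k) u ∈ W) {m : Fin n → ℤ}
    (hm : m (lo k) < m (hi k)) (hW : wtSpan N (m + simpleRoot k) ≤ W) : wtSpan N m ≤ W := by
  have h1 := simpleRoot_lo k
  have h2 := simpleRoot_hi k
  have := wtSpace_le_of_lower_le (q := (r : ℂ) ^ 2) (h := m (hi k) - m (lo k))
    (wtSpace := fun t => wtSpan N (m - t • simpleRoot k))
    (F := tensorRep N (vectorRep n r) (Uq.e r k))
    (pow_ne_zero 2 r.ne_zero) hq
    (fun t u hu => tensorRep_f_mem_wtSpan r k (by module) hu)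
    (fun t u hu => tensorRep_e_mem_wtSpan r k (by module) hu)
    (fun t u hu => by
      rw [← neg_sub (tensorRep N (vectorRep n r) (Uq.e r k) _), smul_neg,
        commutator_of_mem_wtSpan r k hu, ← neg_one_smul ℂ, smul_smul, neg_one_mul, neg_sub]
      congr 4 <;> simp only [Pi.sub_apply, Pi.smul_apply, h1, h2, smul_eq_mul] <;> ring)
    (by omega) ((m (lo k)).toNat + 1)
    (wtSpan_eq_bot (c := lo k) (by simp [h1])) hWF (by simpa using hW)
  simpa using this

end Moves

end Weights

/-! ### Reaching every weight from `(1, …, 1)`. -/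

section Generation

variable {n : ℕ}

/-- The partial sums of `m - (1, …, 1)`. -/
def excess (m : Fin n → ℤ) (p : ℕ) : ℤ := ∑ i : Fin n, if (i : ℕ) < p then m i - 1 else 0

theorem excess_zero (m : Fin n → ℤ) : excess m 0 = 0 := by simp [excess]

theorem excess_self (m : Fin n → ℤ) : excess m n = ∑ c, m c - n := by simp [excess]

theorem excess_succ (m : Fin n → ℤ) (i : Fin n) : excess m (i + 1) = excess m i + (m i - 1) := by
  rw [← sub_eq_iff_eq_add', excess, excess, ← Finset.sum_sub_distrib, Finset.sum_eq_single i]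
  · simp
  · intro j _ hj
    have : (j : ℕ) < i + 1 ↔ (j : ℕ) < i := by
      have := Fin.val_ne_of_ne hj
      omega
    simp [this]
  · simp

/-- The changes `t` at `lo k` and `-t` at `hi k` cancel in every partial sum that contains both
positions. Partial sums thus turn root moves into changes of a single coordinate. -/
theorem excess_add_smul_simpleRoot (m : Fin n → ℤ) (t : ℤ) (k : Fin (n - 1)) (p : ℕ) :
    excess (m + t • simpleRoot k) p = excess m p + if p = k + 1 then t else 0 := by
  have h1 (i : Fin n) : (if (i : ℕ) < p then (m + t • simpleRoot k) i - 1 else 0)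
      = (if (i : ℕ) < p then m i - 1 else 0) + ((if i = lo k then (if (i : ℕ) < p then t else 0)
        else 0) - if i = hi k then (if (i : ℕ) < p then t else 0) else 0) := by
    simp only [simpleRoot, Pi.add_apply, Pi.smul_apply, Pi.sub_apply, Pi.single_apply, smul_eq_mul]
    split_ifs <;> ring
  simp only [excess, h1, Finset.sum_add_distrib, Finset.sum_sub_distrib, Finset.sum_ite_eq',
    Finset.mem_univ, if_true]
  congr 1
  simp only [lo, hi]
  split_ifs <;> omega

theorem eq_one_of_excess_eq_zero {m : Fin n → ℤ} (h : ∀ p ≤ n, excess m p = 0) : m = 1 := by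
  funext i
  have := excess_succ m i
  rw [h _ i.2, h _ i.2.le] at this
  simp only [Pi.one_apply]
  omega

/-- The decrease of the measure on which the descent to `(1, …, 1)` runs. -/
theorem sum_natAbs_excess_lt {m m' : Fin n → ℤ} {k : Fin (n - 1)}
    (hk : (excess m' (k + 1)).natAbs < (excess m (k + 1)).natAbs)
    (hne : ∀ p : ℕ, p ≠ k + 1 → excess m' p = excess m p) :
    ∑ p ∈ Finset.range n, (excess m' p).natAbs < ∑ p ∈ Finset.range n, (excess m p).natAbs := by
  refine Finset.sum_lt_sum (fun p _ => ?_) ⟨k + 1, Finset.mem_range.mpr (by omega), hk⟩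
  by_cases h : p = k + 1
  · exact h ▸ hk.le
  · rw [hne p h]

theorem sum_simpleRoot (k : Fin (n - 1)) : ∑ c, simpleRoot k c = 0 := by
  simp [simpleRoot]

variable {N : ℕ} {r : ℂˣ} (hq : ∀ k : ℕ, 0 < k → ((r : ℂ) ^ 2) ^ k ≠ 1)
  {W : Submodule ℂ (⨂[ℂ] _ : Fin N, (Fin n → ℂ))}
  (hWE : ∀ k, ∀ u ∈ W, tensorRep N (vectorRep n r) (Uq.e r k) u ∈ W)
  (hWF : ∀ k, ∀ u ∈ W, tensorRep N (vectorRep n r) (Uq.f r k) u ∈ W)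

-- Descent on the sum of the absolute values of the partial sums of `m - (1, …, 1)`. At a positive
-- strictly concave point the weight is the upper end of an allowed `e_k`-move from a weight of
-- smaller measure; at a negative strictly convex point the same holds with `f_k`; if neither a
-- positive nor a negative partial sum exists, then `m = (1, …, 1)`.
include hq hWE hWF in
theorem wtSpan_le_of_wtSpan_one_le (h1 : wtSpan N 1 ≤ W) (m : Fin n → ℤ) (hm : ∑ c, m c = n) :
    wtSpan N m ≤ W := by
  induction hd : ∑ p ∈ Finset.range n, (excess m p).natAbs using Nat.strong_induction_on
    generalizing m with
  | _ d ih =>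
  subst hd
  have h0 := excess_zero m
  have hn : excess m n = 0 := by rw [excess_self, hm, sub_self]
  by_cases hpos : ∃ p ≤ n, 0 < excess m p
  · obtain ⟨k, hk, hk0, hk1⟩ := exists_strict_concave_of_pos h0 hn hpos
    -- With numbering from `0`, the increments of the partial sums on the two sides of `k + 1` are
    -- the entries at `lo k` and `hi k` minus `1`, so strict concavity there becomes `m (hi k) < m
    -- (lo k)`.
    have e1 := excess_succ m (lo ⟨k, by omega⟩)
    have e2 := excess_succ m (hi ⟨k, by omega⟩)
    simp only [lo, hi] at e1 e2
    have hx := excess_add_smul_simpleRoot m (-1) ⟨k, by omega⟩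
    simp only at hx
    refine wtSpan_le_of_raise hq (k := ⟨k, by omega⟩) (hWE _) ?_ ?_
    rotate_left
    · rw [show m - simpleRoot ⟨k, by omega⟩ = m + (-1 : ℤ) • simpleRoot ⟨k, by omega⟩ by module]
      refine ih _ ?_ _ ?_ rfl
      · refine sum_natAbs_excess_lt (k := ⟨k, by omega⟩) ?_ fun p hp => ?_
        · rw [hx]; simp only [if_true]; omega
        · rw [hx, if_neg hp, add_zero]
      · simp only [Pi.add_apply, Pi.smul_apply, Finset.sum_add_distrib, ← Finset.smul_sum,
          sum_simpleRoot, hm, smul_zero, add_zero]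
    · change excess m (k + 2) = _ at e2
      simp only [lo, hi]
      omega
  by_cases hneg : ∃ p ≤ n, excess m p < 0
  · obtain ⟨k, hk, hk0, hk1⟩ := exists_strict_concave_of_pos (S := fun p => -excess m p) (n := n)
      (by simp [h0]) (by simp [hn]) (by simpa using hneg)
    have e1 := excess_succ m (lo ⟨k, by omega⟩)
    have e2 := excess_succ m (hi ⟨k, by omega⟩)
    simp only [lo, hi] at e1 e2
    have hx := excess_add_smul_simpleRoot m 1 ⟨k, by omega⟩
    simp only at hx
    refine wtSpan_le_of_lower hq (k := ⟨k, by omega⟩) (hWF _) ?_ ?_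
    rotate_left
    · rw [← one_smul ℤ (simpleRoot _)]
      refine ih _ ?_ _ ?_ rfl
      · refine sum_natAbs_excess_lt (k := ⟨k, by omega⟩) ?_ fun p hp => ?_
        · rw [hx]; simp only [if_true]; omega
        · rw [hx, if_neg hp, add_zero]
      · simp only [Pi.add_apply, Pi.smul_apply, Finset.sum_add_distrib, ← Finset.smul_sum,
          sum_simpleRoot, hm, smul_zero, add_zero]
    · change excess m (k + 2) = _ at e2
      simp only [lo, hi]
      omega
  · push Not at hpos hneg
    rwa [eq_one_of_excess_eq_zero fun p hp => le_antisymm (hpos p hp) (hneg p hp)]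

end Generation

/-! ### The weight `(1, …, 1)` and the generator `v_1 ⊗ ⋯ ⊗ v_n`. -/

section Permutations

variable {n : ℕ} {r : ℂˣ} {W : Submodule ℂ (⨂[ℂ] _ : Fin n, (Fin n → ℂ))}
  (hWE : ∀ k, ∀ u ∈ W, tensorRep n (vectorRep n r) (Uq.e r k) u ∈ W)
  (hWF : ∀ k, ∀ u ∈ W, tensorRep n (vectorRep n r) (Uq.f r k) u ∈ W)

-- In a tensor with distinct labels, `e_k` turns the unique `v_{k+1}` into a second `v_k`; then
-- `f_k` turns either of the two into `v_{k+1}`, which restores the tensor or exchanges the two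
-- labels. All coefficients are powers of `r`, so the exchanged tensor can be solved for.
include hWE hWF in
theorem basisTensor_swap_mul_mem (k : Fin (n - 1)) (w : Equiv.Perm (Fin n))
    (hw : basisTensor w ∈ W) : basisTensor (Equiv.swap (lo k) (hi k) * w : Equiv.Perm _) ∈ W := by
  have hne := lo_ne_hi k
  set a := w.symm (lo k) with ha
  set b := w.symm (hi k) with hb
  have hwa : w a = lo k := by simp [ha]
  have hwb : w b = hi k := by simp [hb]
  have hab : a ≠ b := fun h => hne (by rw [← hwa, ← hwb, h])
  have hE := hWE k _ hw
  rw [tensorRep_e_basisTensor, Finset.sum_eq_single b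
    (fun l _ hl => if_neg fun h => hl (by rw [hb, ← h, Equiv.symm_apply_apply])) (by simp),
    if_pos hwb, Submodule.smul_mem_iff _ (siteCoeff_ne_zero r k _ _)] at hE
  have hF := hWF k _ hE
  set j := Function.update (⇑w) b (lo k) with hj
  have hja : j a = lo k := by rw [hj, Function.update_of_ne hab, hwa]
  have hjb : j b = lo k := by rw [hj, Function.update_self]
  rw [tensorRep_f_basisTensor, Fintype.sum_eq_add a b hab, if_pos hja, if_pos hjb] at hF
  · have e1 : Function.update j b (hi k) = w := by
      rw [hj, Function.update_idem, ← hwb, Function.update_eq_self]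
    have e2 : Function.update j a (hi k) = ⇑(Equiv.swap (lo k) (hi k) * w) := by
      funext i
      rw [Equiv.Perm.mul_apply]
      by_cases hia : i = a
      · subst hia; rw [Function.update_self, hwa, Equiv.swap_apply_left]
      · rw [Function.update_of_ne hia]
        by_cases hib : i = b
        · subst hib; rw [hjb, hwb, Equiv.swap_apply_right]
        · rw [hj, Function.update_of_ne hib, Equiv.swap_apply_of_ne_of_ne]
          · rw [← hwa]; exact w.injective.ne hia
          · rw [← hwb]; exact w.injective.ne hib
    rw [e1, e2] at hF
    -- The summand from position `b` is a multiple of the original tensor, so the summand from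
    -- position `a` alone lies in `W`.
    have := (Submodule.add_mem_iff_left _ (Submodule.smul_mem _ _ hw)).mp hF
    exact (Submodule.smul_mem_iff _ (siteCoeff_ne_zero r k _ _)).mp this
  · rintro l ⟨hla, hlb⟩
    rw [hj, Function.update_of_ne hlb, if_neg]
    intro h
    exact hla (by rw [ha, ← h, Equiv.symm_apply_apply])

-- Adjacent transpositions generate the symmetric group. They multiply on the left because `e_k` and
-- `f_k` change labels and not positions.
include hWE hWF in
theorem basisTensor_perm_mem (h1 : basisTensor id ∈ W) (w : Equiv.Perm (Fin n)) :
    basisTensor w ∈ W := by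
  rcases n with _ | n
  · rwa [Subsingleton.elim (⇑w) id]
  have hw : w ∈ Submonoid.closure
      (Set.range fun i : Fin n => Equiv.swap i.castSucc i.succ) := by
    rw [Equiv.Perm.mclosure_swap_castSucc_succ]; trivial
  induction hw using Submonoid.closure_induction_left with
  | one => exact h1
  | mul_left x hx y _ ih =>
    obtain ⟨i, rfl⟩ := hx
    exact basisTensor_swap_mul_mem hWE hWF (n := n + 1) i y ih

theorem bijective_of_wt_eq_one {j : Fin n → Fin n} (h : wt j = 1) : Function.Bijective j := by
  refine Finite.surjective_iff_bijective.mp fun c => ?_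
  by_contra! hc
  have := congrFun h c
  simp [wt, hc] at this

/-- The tensor `v_1 ⊗ ⋯ ⊗ v_n` generates `(ℂ^n)^{⊗n}`. -/
theorem range_tensorRep_basisTensor_id (hq : ∀ k : ℕ, 0 < k → ((r : ℂ) ^ 2) ^ k ≠ 1) :
    LinearMap.range ((LinearMap.applyₗ (basisTensor (id : Fin n → Fin n))).comp
      (tensorRep n (vectorRep n r)).toLinearMap) = ⊤ := by
  set W := LinearMap.range ((LinearMap.applyₗ (basisTensor (id : Fin n → Fin n))).comp
      (tensorRep n (vectorRep n r)).toLinearMap)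
  have hW (x : Uq n r) : ∀ u ∈ W, tensorRep n (vectorRep n r) x u ∈ W := by
    rintro _ ⟨y, rfl⟩
    exact ⟨x * y, by simp⟩
  have hE (k : Fin (n - 1)) := hW (Uq.e r k)
  have hF (k : Fin (n - 1)) := hW (Uq.f r k)
  have h1 : basisTensor id ∈ W := ⟨1, by simp⟩
  refine eq_top_of_basisTensor_mem fun j => ?_
  -- The descent applies to every basis tensor, because with `n` factors the entries of its weight
  -- sum to `n`; what remains is the weight `(1, …, 1)`, whose basis tensors come from permutations.
  refine wtSpan_le_of_wtSpan_one_le hq hE hF (wtSpan_le_iff.mpr fun w hw => ?_) _ (sum_wt j)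
    (basisTensor_mem_wtSpan rfl)
  exact basisTensor_perm_mem hE hF h1 (Equiv.ofBijective w (bijective_of_wt_eq_one hw))

/-! ### Transfer to `A_q` along `Φ`. -/

theorem alphaDetMap_basisTensor (α : ℂ) (j : Fin n → Fin n) :
    alphaDetMap r α (basisTensor j) = alphaDetAt r α j :=
  alphaDetMap_tprod r α j

/-- The whole tensor power is `U_q · (v_1 ⊗ ⋯ ⊗ v_n)`, and an equivariant map sends the orbit of a
vector onto the orbit of its image, here `det_q^{(α)}`. -/
theorem range_alphaDetMap (hq : ∀ k : ℕ, 0 < k → ((r : ℂ) ^ 2) ^ k ≠ 1) (α : ℂ) :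
    LinearMap.range (alphaDetMap (n := n) r α) = cyclicModule n r α := by
  rw [LinearMap.range_eq_map, ← range_tensorRep_basisTensor_id hq, ← LinearMap.range_comp,
    cyclicModule]
  congr 1
  ext u
  simp only [LinearMap.comp_apply, LinearMap.applyₗ_apply_apply, AlgHom.toLinearMap_apply,
    alphaDetMap_tensorRep, alphaDetMap_basisTensor]
  rfl

theorem range_alphaDetMap_eq_span (r : ℂˣ) (α : ℂ) :
    LinearMap.range (alphaDetMap (n := n) r α)
      = Submodule.span ℂ (Set.range fun j : Fin n → Fin n => alphaDetAt r α j) := by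
  have htop : Submodule.span ℂ (Set.range (basisTensor (n := n) (N := n))) = ⊤ :=
    eq_top_of_basisTensor_mem fun j => Submodule.subset_span ⟨j, rfl⟩
  rw [LinearMap.range_eq_map, ← htop, Submodule.map_span, ← Set.range_comp]
  congr 2
  funext j
  exact alphaDetMap_basisTensor α j

end Permutations

end QuantumAlpha

theorem mainTheorem8 (n : ℕ) (r : ℂˣ) (hq : ∀ k : ℕ, 0 < k → ((r : ℂ) ^ 2) ^ k ≠ 1) (α : ℂ) :
    QuantumAlpha.cyclicModule n r α
        = Submodule.span ℂ (Set.range fun j : Fin n → Fin n => QuantumAlpha.alphaDetAt r α j) ∧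
      ∃ Φ : (⨂[ℂ] _ : Fin n, (Fin n → ℂ)) →ₗ[ℂ] QuantumAlpha.cyclicModule n r α,
        (∀ j : Fin n → Fin n,
          (Φ (PiTensorProduct.tprod ℂ fun i => Pi.single (j i) (1 : ℂ)) :
              QuantumAlpha.Aq n ((r : ℂ) ^ 2))
            = QuantumAlpha.alphaDetAt r α j) ∧
        Function.Surjective Φ ∧
        ∀ (u : QuantumAlpha.Uq n r) (t : ⨂[ℂ] _ : Fin n, (Fin n → ℂ)),
          (Φ (QuantumAlpha.tensorRep n (QuantumAlpha.vectorRep n r) u t) :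
              QuantumAlpha.Aq n ((r : ℂ) ^ 2))
            = QuantumAlpha.rho n r u (Φ t) := by
  -- Both claims come from computing the range of one map twice: as the cyclic module and as the
  -- span of the `D(j_1, …, j_n)`. The first computation also allows the codomain to be restricted
  -- and gives surjectivity.
  have hrange := QuantumAlpha.range_alphaDetMap (n := n) hq α
  refine ⟨hrange.symm.trans (QuantumAlpha.range_alphaDetMap_eq_span r α),
    (QuantumAlpha.alphaDetMap r α).codRestrict _
      fun t => hrange.le (LinearMap.mem_range_self _ t), fun j => ?_, fun y => ?_, fun u t => ?_⟩
  · exact QuantumAlpha.alphaDetMap_tprod r α j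
  · obtain ⟨t, ht⟩ := LinearMap.mem_range.mp (hrange.ge y.2)
    exact ⟨t, Subtype.ext ht⟩
  · exact QuantumAlpha.alphaDetMap_tensorRep r α u t
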